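/- **Setting.** Let $A=\{a_1,\dots,a_K\}$ be a finite set of arms whose rewards $X(a_1),\dots,X(a_K)$ are independent integrable random variables with means $\mu(a_i)=\mathbb E[X(a_i)]\neq 0$; the default arm $a_0$ always has reward $0$. Rewards are static: $X(a_i)$ is realized once, and every selection of $a_i$ pays this same value. In each round $t$ a (randomized) mechanism maps, measurably, the history $\mathcal I_t$ of previously selected arms and their rewards to a portfolio $\mathbf p^t$, a probability distribution on $A\cup\{a_0\}$; an arm is then drawn from $\mathbf p^t$ and its reward $r^t$ is observed. The mechanism is MIR if $\sum_{a}\mathbf p^t(a)\,\mathbb E[X(a)\mid\mathcal I_t]\ge 0$ for every $t$ and every possible history $\mathcal I_t$. Its social welfare is $SW_T=\mathbb E\big[\tfrac1T\sum_{t=1}^T r^t\big]$. Let $\mathrm{OPT}_T$ be the supremum of $SW_T$ over all MIR mechanisms and $\mathrm{OPT}_\infty=\lim_{T\to\infty}\mathrm{OPT}_T$. **The algorithm IREGB.** Let $s$ be the set of unexplored arms, initially $s=A$; it is terminal if no probability distribution on $s$ has nonnegative prior mean reward. 1. While $s$ is not terminal, choose any $a_i\in s$ with $\mu(a_i)>0$.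 If no arm of $s$ has negative mean, select $a_i$. Otherwise choose any $a_j\in s$ whose mean is maximal among the arms of $s$ of negative mean, and select the portfolio that gives $a_i$ weight $\frac{-\mu(a_j)}{\mu(a_i)-\mu(a_j)}$ and $a_j$ weight $\frac{\mu(a_i)}{\mu(a_i)-\mu(a_j)}$. Remove the realized arm from $s$. 2. When $s$ is terminal: if a positive reward has been observed, let $a_k$ be an arm with the highest observed reward $x>0$. As long as there are unexplored arms, choose any unexplored arm $a_j$ and select the portfolio that gives $a_k$ weight $\frac{-\mu(a_j)}{x-\mu(a_j)}$ and $a_j$ weight $\frac{x}{x-\mu(a_j)}$ (a Bernoulli trial). Once all arms are explored, select an arm of highest reward forever. 3. When $s$ is terminal and no positive reward has been observed, select $a_0$ forever. **Statement.** Assume that the rewards of the arms of negative mean are stochastically ordered: for any two such arms $a,b$, either $\Pr(X(a)\ge c)\ge\Pr(X(b)\ge c)$ for all $c\in\mathbb R$, or the reverse inequality holds for all $c\in\mathbb R$. Then $\mathrm{OPT}_T$ is finite for every $T$, the limit $\mathrm{OPT}_\infty$ exists, and, however the open choices are made, IREGB is MIR and $$\lim_{T\to\infty}SW_T(\mathrm{IREGB})=\mathrm{OPT}_\infty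 .$$ Moreover, given the means, IREGB can be implemented (sorting the arms of negative mean by merge sort) so that, counting operations on reals, arms and lists as unit cost, the computation of all portfolios it ever selects takes $O(K\log K)$ operations in total for $K\ge2$, and every single round takes $O(1)$ operations, with constants that do not depend on the instance. (The total does not count the $O(1)$ bookkeeping of rounds in which no arm is newly explored and the previous portfolio is simply selected again.) -/

import Mathlib

open MeasureTheory ProbabilityTheory Filter Topology

noncomputable section

namespace IRSR

/-! ### Instances, histories, mechanisms

The arms are indexed by `Fin K`; `Option (Fin K)` is the set of arms together with the default arm,
which is `none` and always has reward `0`. -/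

/-- The expected rewards `μ(a) = E[X(a)]`. -/
def mean {Ω : Type*} [MeasurableSpace Ω] (P : Measure Ω) {K : ℕ} (X : Fin K → Ω → ℝ) :
    Fin K → ℝ :=
  fun i => ∫ ω, X i ω ∂P

/-- First-order stochastic dominance of the random variable `Y` over the random variable `Z`. -/
def StochDominates {Ω : Type*} [MeasurableSpace Ω] (P : Measure Ω) (Y Z : Ω → ℝ) : Prop :=
  ∀ c : ℝ, P {ω | c ≤ Z ω} ≤ P {ω | c ≤ Y ω}

/-- The rewards of the arms with negative mean are (totally) ordered by stochastic dominance. -/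
def NegStochOrdered {Ω : Type*} [MeasurableSpace Ω] (P : Measure Ω) {K : ℕ}
    (X : Fin K → Ω → ℝ) : Prop :=
  ∀ i j : Fin K, mean P X i < 0 → mean P X j < 0 →
    StochDominates P (X i) (X j) ∨ StochDominates P (X j) (X i)

/-- The reward of an arm (or of the default arm) when the reward vector is `x`. -/
def reward {K : ℕ} (x : Fin K → ℝ) : Option (Fin K) → ℝ
  | none => 0
  | some i => x i

/-- The information of a mechanism: the selected arms and their rewards, in chronological order. -/
abbrev History (K : ℕ) := List (Option (Fin K) × ℝ)

/-- Arms of `A` already selected in the history. -/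
def explored {K : ℕ} (h : History K) : Finset (Fin K) :=
  Finset.univ.filter fun i => some i ∈ h.map Prod.fst

/-- Arms of `A` not yet selected in the history. -/
def unexplored {K : ℕ} (h : History K) : Finset (Fin K) := (explored h)ᶜ

/-- A map from histories to portfolios (weights on the arms and the default arm). -/
abbrev Strategy (K : ℕ) := History K → Option (Fin K) → ℝ

/-- A strategy is a randomized mechanism if its values are probability distributions which depend
measurably on the observed rewards. -/
structure IsMechanism {K : ℕ} (M : Strategy K) : Prop where
  nonneg : ∀ h a, 0 ≤ M h a
  sum_eq_one : ∀ h, ∑ a, M h a = 1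
  measurable : ∀ (n : ℕ) (a : Fin n → Option (Fin K)) (b : Option (Fin K)),
    Measurable fun x : Fin n → ℝ => M (List.ofFn fun t => (a t, x t)) b

/-- `h` can be the information of `M` at some round: its rewards come from some reward vector, and
each of its arms had positive weight in the portfolio that `M` selected in that round. -/
def Possible {K : ℕ} (M : Strategy K) (h : History K) : Prop :=
  (∃ x : Fin K → ℝ, ∀ e ∈ h, e.2 = reward x e.1) ∧
    ∀ (g : History K) (e : Option (Fin K) × ℝ), g ++ [e] <+: h → 0 < M g e.1

/-- `E[X(a) | h]`: the default arm has reward `0`, the reward of an arm selected in `h` is known,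
and, the rewards being independent, any other arm still has its prior mean. -/
def condMean {K : ℕ} (μ : Fin K → ℝ) (h : History K) : Option (Fin K) → ℝ
  | none => 0
  | some i =>
    match h.find? (fun e => decide (e.1 = some i)) with
    | some e => e.2
    | none => μ i

/-- Ex-ante mechanism-informed individual rationality: for every possible information, the
selected portfolio has a nonnegative conditional expected reward. -/
def IsMIR {K : ℕ} (μ : Fin K → ℝ) (M : Strategy K) : Prop :=
  ∀ h, Possible M h → 0 ≤ ∑ a, M h a * condMean μ h a

/-! ### Social welfare -/

/-- Expected total reward (over the draws of arms from the portfolios) that `M` collects in the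
next `n` rounds after the history `h`, when the reward vector is `x`. -/
def totalReward {K : ℕ} (M : Strategy K) (x : Fin K → ℝ) : ℕ → History K → ℝ
  | 0, _ => 0
  | n + 1, h => ∑ a, M h a * (reward x a + totalReward M x n (h ++ [(a, reward x a)]))

/-- Social welfare `E[(1/T) ∑_{t ≤ T} r^t]`. -/
def SW {Ω : Type*} [MeasurableSpace Ω] (P : Measure Ω) {K : ℕ} (X : Fin K → Ω → ℝ)
    (M : Strategy K) (T : ℕ) : ℝ :=
  ∫ ω, (1 / (T : ℝ)) * totalReward M (fun i => X i ω) T [] ∂P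

/-- The values of social welfare over `T` rounds that MIR mechanisms attain. -/
def achievable {Ω : Type*} [MeasurableSpace Ω] (P : Measure Ω) {K : ℕ} (X : Fin K → Ω → ℝ)
    (T : ℕ) : Set ℝ :=
  {w | ∃ M : Strategy K, IsMechanism M ∧ IsMIR (mean P X) M ∧ SW P X M T = w}

/-- `OPT_T`, the highest social welfare of MIR mechanisms over `T` rounds. -/
def OPT {Ω : Type*} [MeasurableSpace Ω] (P : Measure Ω) {K : ℕ} (X : Fin K → Ω → ℝ)
    (T : ℕ) : ℝ :=
  sSup (achievable P X T)

/-! ### The algorithm IREGB -/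

/-- MIR portfolios, with respect to the prior, over the arms in `s`. -/
def MIRSet {K : ℕ} (μ : Fin K → ℝ) (s : Finset (Fin K)) : Set (Fin K → ℝ) :=
  {p | (∀ a, 0 ≤ p a) ∧ (∀ a ∉ s, p a = 0) ∧ ∑ a ∈ s, p a = 1 ∧ 0 ≤ ∑ a ∈ s, p a * μ a}

/-- A set `s` of unexplored arms is terminal if it supports no MIR portfolio. -/
def Terminal {K : ℕ} (μ : Fin K → ℝ) (s : Finset (Fin K)) : Prop := MIRSet μ s = ∅

/-- The portfolio that selects `a` with certainty. -/
def pick {K : ℕ} (a : Option (Fin K)) : Option (Fin K) → ℝ := fun c => if c = a then 1 else 0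

/-- The portfolio with expected value zero that mixes `i`, of expected value `v`, and `j`, of
expected value `w`, where `w < 0 < v`. -/
def mix {K : ℕ} (i : Fin K) (v : ℝ) (j : Fin K) (w : ℝ) : Option (Fin K) → ℝ := fun c =>
  if c = some i then -w / (v - w) else if c = some j then v / (v - w) else 0

/-- `g` is the part of `h` up to the moment at which the set of unexplored arms first became
terminal. -/
def IsExplorationPart {K : ℕ} (μ : Fin K → ℝ) (h g : History K) : Prop :=
  g <+: h ∧ Terminal μ (unexplored g) ∧ ∀ g', g' <+: g → g' ≠ g → ¬ Terminal μ (unexplored g')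

/-- `IREGBMove μ h p`: after the history `h`, the algorithm IREGB may select the portfolio `p`
(the algorithm leaves some choices open).
* `ogpMix`, `ogpSingle`: while the set of unexplored arms is not terminal, the policy OGP is
  followed: any unexplored arm of positive mean is mixed with an unexplored arm of negative mean
  whose mean is as large as possible, or selected with certainty if no unexplored arm has negative
  mean.
* `trial`: if a positive reward was found before the terminal state was reached, the best arm
  found by then is mixed in Bernoulli trials with the unexplored arms until all are explored.
* `exploit`: then the best arm is selected forever.
* `giveUp`: if no positive reward was found, the default arm is selected forever. -/
inductive IREGBMove {K : ℕ} (μ : Fin K → ℝ) (h : History K) : (Option (Fin K) → ℝ) → Prop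
  | ogpMix (i j : Fin K) (hs : ¬ Terminal μ (unexplored h))
      (hi : i ∈ unexplored h) (hi0 : 0 < μ i) (hj : j ∈ unexplored h) (hj0 : μ j < 0)
      (hmax : ∀ j' ∈ unexplored h, μ j' < 0 → μ j' ≤ μ j) :
      IREGBMove μ h (mix i (μ i) j (μ j))
  | ogpSingle (i : Fin K) (hs : ¬ Terminal μ (unexplored h))
      (hi : i ∈ unexplored h) (hi0 : 0 < μ i) (hneg : ∀ j ∈ unexplored h, ¬ μ j < 0) :
      IREGBMove μ h (pick (some i))
  | trial (g : History K) (k j : Fin K) (x : ℝ) (hg : IsExplorationPart μ h g)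
      (hk : (some k, x) ∈ g) (hx : 0 < x) (hmax : ∀ e ∈ g, e.2 ≤ x) (hj : j ∈ unexplored h) :
      IREGBMove μ h (mix k x j (μ j))
  | exploit (g : History K) (k : Fin K) (x : ℝ) (hg : IsExplorationPart μ h g)
      (hpos : ∃ e ∈ g, 0 < e.2) (hall : unexplored h = ∅)
      (hk : (some k, x) ∈ h) (hmax : ∀ e ∈ h, e.2 ≤ x) :
      IREGBMove μ h (pick (some k))
  | giveUp (g : History K) (hg : IsExplorationPart μ h g) (hnonpos : ∀ e ∈ g, e.2 ≤ 0) :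
      IREGBMove μ h (pick none)

/-- `M` is an execution of IREGB, with arbitrary (possibly history-dependent) resolution of the
choices that the algorithm leaves open. -/
def IsIREGB {K : ℕ} (μ : Fin K → ℝ) (M : Strategy K) : Prop :=
  ∀ h, Possible M h → IREGBMove μ h (M h)

/-! ### An implementation of IREGB with a count of elementary operations

One unit of time is charged for each comparison or arithmetic operation on real numbers, each
comparison of arms and each elementary operation on lists. -/

/-- A value together with the number of operations used to compute it. -/
@[ext]
structure Timed (α : Type) where
  val : α
  cost : ℕ

instance : Monad Timed where
  pure a := ⟨a, 0⟩
  bind x f := ⟨(f x.val).val, x.cost + (f x.val).cost⟩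

/-- Charge `n` operations. -/
def tick (n : ℕ) : Timed Unit := ⟨(), n⟩

/-- Separate the arms with positive mean from the others. -/
def classify {K : ℕ} (μ : Fin K → ℝ) : List (Fin K) → Timed (List (Fin K) × List (Fin K))
  | [] => do
    tick 1
    return ([], [])
  | i :: l => do
    tick 3
    let r ← classify μ l
    if 0 < μ i then return (i :: r.1, r.2) else return (r.1, i :: r.2)

/-- Merge two lists that are sorted by decreasing mean. -/
def merge {K : ℕ} (μ : Fin K → ℝ) : List (Fin K) → List (Fin K) → Timed (List (Fin K))
  | [], l => do
    tick 1
    return l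
  | i :: l, [] => do
    tick 2
    return i :: l
  | i :: l, j :: l' => do
    tick 4
    if μ j ≤ μ i then
      let r ← merge μ l (j :: l')
      return i :: r
    else
      let r ← merge μ (i :: l) l'
      return j :: r
termination_by l l' => l.length + l'.length

/-- Merge sort by decreasing mean. Measuring and halving a list of length `n` takes `3 * n`
operations. -/
def sortByMean {K : ℕ} (μ : Fin K → ℝ) : List (Fin K) → Timed (List (Fin K))
  | [] => do
    tick 1
    return []
  | [i] => do
    tick 2
    return [i]
  | i :: j :: l => do
    tick (3 * (i :: j :: l).length)
    let l₁ ← sortByMean μ ((i :: j :: l).take ((i :: j :: l).length / 2))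
    let l₂ ← sortByMean μ ((i :: j :: l).drop ((i :: j :: l).length / 2))
    merge μ l₁ l₂
termination_by l => l.length
decreasing_by
  all_goals simp only [List.length_take, List.length_drop, List.length_cons]; omega

/-- The memory of the implementation: the unexplored arms of positive mean, the unexplored arms of
negative mean, the best explored arm with its reward, and the arm used in the Bernoulli trials with
its reward. -/
structure Memory (K : ℕ) where
  pos : List (Fin K)
  neg : List (Fin K)
  best : Option (Fin K × ℝ)
  anchor : Option (Fin K × ℝ)

/-- Preprocessing: sort the arms of negative mean. -/
def prepare {K : ℕ} (μ : Fin K → ℝ) : Timed (Memory K) := do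
  let r ← classify μ (List.finRange K)
  let neg ← sortByMean μ r.2
  return { pos := r.1, neg := neg, best := none, anchor := none }

/-- A portfolio that is stored as two arms and their probabilities. -/
structure Lottery (K : ℕ) where
  fst : Option (Fin K)
  pFst : ℝ
  snd : Option (Fin K)
  pSnd : ℝ

/-- The weights of a stored portfolio. -/
def Lottery.weights {K : ℕ} (q : Lottery K) : Option (Fin K) → ℝ := fun c =>
  (if c = q.fst then q.pFst else 0) + (if c = q.snd then q.pSnd else 0)

/-- Compute the mix, of expected value zero, of arms of expected values `v` and `w`. -/
def mixLottery {K : ℕ} (i : Fin K) (v : ℝ) (j : Fin K) (w : ℝ) : Timed (Lottery K) := do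
  tick 4
  return ⟨some i, -w / (v - w), some j, v / (v - w)⟩

/-- Select one arm with certainty. -/
def pickLottery {K : ℕ} (a : Option (Fin K)) : Timed (Lottery K) := do
  tick 1
  return ⟨a, 1, a, 0⟩

/-- Compute the portfolio to be selected. -/
def play {K : ℕ} (μ : Fin K → ℝ) (m : Memory K) : Timed (Lottery K) := do
  tick 4
  match m.pos, m.neg with
  | i :: _, j :: _ => mixLottery i (μ i) j (μ j)
  | i :: _, [] => pickLottery (some i)
  | [], l =>
    match m.anchor with
    | none => pickLottery none
    | some (k, x) =>
      match l with
      | j :: _ => mixLottery k x j (μ j)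
      | [] => pickLottery (m.best.map Prod.fst)

/-- The better one of the best arm so far and a newly explored arm. -/
def better {K : ℕ} (best : Option (Fin K × ℝ)) (i : Fin K) (r : ℝ) :
    Timed (Option (Fin K × ℝ)) := do
  tick 2
  match best with
  | none => return some (i, r)
  | some (k, x) => if x < r then return some (i, r) else return some (k, x)

/-- The arm for the Bernoulli trials: once no arm of positive mean is left, the best explored arm
if its reward is positive. -/
def chooseAnchor {K : ℕ} (pos : List (Fin K)) (best : Option (Fin K × ℝ)) :
    Timed (Option (Fin K × ℝ)) := do
  tick 3
  match pos, best with
  | [], some (k, x) => if 0 < x then return some (k, x) else return none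
  | _, _ => return none

/-- Update the memory with the arm selected in a round and its reward. -/
def update {K : ℕ} (m : Memory K) (e : Option (Fin K) × ℝ) : Timed (Memory K) := do
  tick 4
  match m.pos, m.neg with
  | i :: l, l' =>
    tick 1
    if e.1 = some i then
      let b ← better m.best i e.2
      let c ← chooseAnchor l b
      return { pos := l, neg := l', best := b, anchor := c }
    else
      match l' with
      | [] => return m
      | j :: l'' =>
        tick 1
        if e.1 = some j then
          let b ← better m.best j e.2
          return { m with neg := l'', best := b }
        else return m
  | [], [] => return m
  | [], j :: l' =>
    match m.anchor with
    | none => return m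
    | some _ =>
      tick 1
      if e.1 = some j then
        let b ← better m.best j e.2
        return { m with neg := l', best := b }
      else return m

/-- The memory after the history `h`. -/
def memoryAfter {K : ℕ} (μ : Fin K → ℝ) (h : History K) : Memory K :=
  h.foldl (fun m e => (update m e).val) (prepare μ).val

/-- The mechanism computed by the implementation. -/
def program {K : ℕ} (μ : Fin K → ℝ) : Strategy K := fun h =>
  (play μ (memoryAfter μ h)).val.weights

/-- Operations in a round: process the observed arm and reward, compute the next portfolio. -/
def roundCost {K : ℕ} (μ : Fin K → ℝ) (m : Memory K) (e : Option (Fin K) × ℝ) : ℕ :=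
  (update m e).cost + (play μ (update m e).val).cost

open Classical in
/-- Operations in all the rounds that change the memory. In the other rounds the portfolio
selected before is just selected again. -/
def changeCost {K : ℕ} (μ : Fin K → ℝ) : Memory K → History K → ℕ
  | _, [] => 0
  | m, e :: h =>
    (if (update m e).val = m then 0 else roundCost μ m e) + changeCost μ (update m e).val h

/-- Operations used to compute all the portfolios that are selected along the history `h`:
preprocessing, first portfolio, and all later changes of the portfolio. -/
def planningCost {K : ℕ} (μ : Fin K → ℝ) (h : History K) : ℕ :=
  (prepare μ).cost + (play μ (prepare μ).val).cost + changeCost μ (prepare μ).val h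

end IRSR

end

open IRSR

/-!
The argument follows one potential. Let `q i` be the probability that the arm `i` is nonpositive and
`W s` the expected positive part of the best reward among the arms `s`. As long as no positive
reward has been found, all that matters is the set `s` of unexplored arms. If the exploration has to
stop there, the loss compared to knowing all rewards is `W s`; let `L s` be the least expected loss
that can be reached from `s`.

The loss has an explicit form. For a set function `f` put `(D f) N = (f N - q t * f (N \ {t})) /
|μ t|`, where `t` is the arm of `N` of least `|μ t|`. One step of the policy OGP that mixes the
arm `i` of positive mean with the best arm of negative mean is the resolvent `(1 + μ i D)⁻¹`. All
these resolvents commute, which is why the order in which OGP uses the arms of positive mean does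
not matter. Hence `L s = (∏ q i) * F N`, where `N` consists of the arms of negative mean in `s`,
and where `F` arises from `W` by applying the resolvents of the arms `i` of positive mean in `s`
(`exists_resolvent_family`). Exploring `a` changes the expected loss by at least `κ s * μ a`,
where `κ s = (∏ q i) * (D F) N ≥ 0`, with equality for the arms that OGP uses (`exists_isLoss`).
For arms of negative mean this says that the marginal `(F N - q a * F (N \ {a})) / |μ a|` is
largest at the arm of least `|μ a|`; it holds for `W` by stochastic dominance
(`TailDominates.integral_bestReward_insert_le`), and the resolvents preserve it
(`MarginalsOrdered.resolvent`).

Consequently a portfolio of nonnegative expected reward cannot decrease the expected loss, and the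
best reward minus the expected loss is a supermartingale along every MIR mechanism, which bounds
the expected reward of each round (`integral_weight_totalReward_le`). Along IREGB it is a martingale
until the unexplored arms become terminal. From then on either only the default arm is selected, or,
for fixed rewards, the Bernoulli trials cost a bounded amount in total (`regret_le`), so that by
dominated convergence the average reward tends to the same value
(`tendsto_integral_weight_totalReward`).

For the implementation, the memory is shown to describe the state of IREGB after every possible
history (`tracks_memoryAfter`). Each change of the memory removes an arm from one of its two lists,
so the running time is dominated by the merge sort (`planningCost_le`).
-/

namespace IRSR

/-! ### The minimal loss of an exploration policy -/

section Loss

variable {ι : Type*}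

/-- An element of `N` of least cost. -/
noncomputable def cheapest (d : ι → ℝ) (N : Finset ι) (h : N.Nonempty) : ι :=
  (N.exists_min_image d h).choose

theorem cheapest_mem (d : ι → ℝ) {N : Finset ι} (h : N.Nonempty) : cheapest d N h ∈ N :=
  (N.exists_min_image d h).choose_spec.1

theorem cheapest_le (d : ι → ℝ) {N : Finset ι} (h : N.Nonempty) {j : ι} (hj : j ∈ N) :
    d (cheapest d N h) ≤ d j :=
  (N.exists_min_image d h).choose_spec.2 j hj

variable [DecidableEq ι]

/-- The decrease of `f` per unit of cost `d j` when `j` is removed from `N` and the rest is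
discounted by `q j`. -/
noncomputable def marginal (q d : ι → ℝ) (j : ι) (f : Finset ι → ℝ) (N : Finset ι) : ℝ :=
  (f N - q j * f (N.erase j)) / d j

/-- The marginal at a cheapest element, as a linear operator on set functions. -/
noncomputable def topMarginal (q d : ι → ℝ) : Module.End ℝ (Finset ι → ℝ) where
  toFun f N := if h : N.Nonempty then marginal q d (cheapest d N h) f N else 0
  map_add' f g := by
    funext N
    by_cases h : N.Nonempty
    · simp only [h, dite_true, marginal, Pi.add_apply]; ring
    · simp [h]
  map_smul' c f := by
    funext N
    by_cases h : N.Nonempty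
    · simp only [h, dite_true, marginal, Pi.smul_apply, smul_eq_mul, RingHom.id_apply]; ring
    · simp [h]

theorem topMarginal_apply (q d : ι → ℝ) (f : Finset ι → ℝ) {N : Finset ι} (h : N.Nonempty) :
    topMarginal q d f N = marginal q d (cheapest d N h) f N := by
  simp [topMarginal, h]

theorem topMarginal_empty (q d : ι → ℝ) (f : Finset ι → ℝ) : topMarginal q d f ∅ = 0 := by
  simp [topMarginal]

/-- Marginals with respect to two elements commute. -/
theorem marginal_marginal (q d : ι → ℝ) (a b : ι) (f : Finset ι → ℝ) (N : Finset ι) :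
    marginal q d a (marginal q d b f) N = marginal q d b (marginal q d a f) N := by
  simp only [marginal, Finset.erase_right_comm (a := a) (b := b)]
  ring

/-- The marginals of `f` on subsets of `U` are larger at cheaper elements. -/
def MarginalsOrdered (q d : ι → ℝ) (U : Set ι) (f : Finset ι → ℝ) : Prop :=
  ∀ N : Finset ι, (↑N : Set ι) ⊆ U → ∀ a ∈ N, ∀ b ∈ N, d b ≤ d a →
    marginal q d a f N ≤ marginal q d b f N

section Resolvent

variable {q d : ι → ℝ} {f h : Finset ι → ℝ} {m : ℝ}

/-- If `h` is the image of `f` under the resolvent `(1 + m D)⁻¹` of the operator `D` of top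
marginals, then the top marginals of `h` obey the same recursion as `h` does. -/
theorem marginal_cheapest_resolvent (hd : ∀ i, 0 < d i) (hres : h + m • topMarginal q d h = f)
    {N : Finset ι} (hN : N.Nonempty) :
    (1 + m / d (cheapest d N hN)) * marginal q d (cheapest d N hN) h N =
      marginal q d (cheapest d N hN) f N + m / d (cheapest d N hN) *
        (q (cheapest d N hN) * topMarginal q d h (N.erase (cheapest d N hN))) := by
  set t := cheapest d N hN with ht
  have h1 : f N = h N + m * marginal q d t h N := by
    rw [← hres, Pi.add_apply, Pi.smul_apply, topMarginal_apply q d h hN, smul_eq_mul]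
  have h2 : f (N.erase t) = h (N.erase t) + m * topMarginal q d h (N.erase t) := by
    rw [← hres, Pi.add_apply, Pi.smul_apply, smul_eq_mul]
  have h0 := (hd t).ne'
  have h3 : marginal q d t f N = marginal q d t h N +
      m / d t * (marginal q d t h N - q t * topMarginal q d h (N.erase t)) := by
    conv_lhs => rw [marginal, h1, h2]
    generalize topMarginal q d h (N.erase t) = z
    generalize hy : marginal q d t h N = y
    rw [← hy, marginal]
    field_simp
    ring
  rw [h3]
  ring

theorem topMarginal_resolvent_nonneg (hd : ∀ i, 0 < d i) (hq : ∀ i, 0 ≤ q i) (hm : 0 ≤ m)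
    (hres : h + m • topMarginal q d h = f) {U : Set ι}
    (hf : ∀ N : Finset ι, (↑N : Set ι) ⊆ U → 0 ≤ topMarginal q d f N) :
    ∀ N : Finset ι, (↑N : Set ι) ⊆ U → 0 ≤ topMarginal q d h N := by
  intro N
  induction N using Finset.strongInduction with
  | H N ih =>
    intro hNU
    rcases N.eq_empty_or_nonempty with rfl | hN
    · rw [topMarginal_empty]
    have key := marginal_cheapest_resolvent hd hres hN
    have hfN := hf N hNU
    rw [topMarginal_apply q d _ hN] at hfN ⊢
    set t := cheapest d N hN with ht
    have hih := ih (N.erase t) (Finset.erase_ssubset (cheapest_mem d hN))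
      (fun x hx => hNU (Finset.mem_of_mem_erase hx))
    have hmd : 0 ≤ m / d t := div_nonneg hm (hd t).le
    have : 0 ≤ (1 + m / d t) * marginal q d t h N := by
      rw [key]
      have := hq t
      positivity
    exact nonneg_of_mul_nonneg_right this (by positivity)

/-- The resolvent keeps the marginals ordered. -/
theorem MarginalsOrdered.resolvent (hd : ∀ i, 0 < d i) (hq : ∀ i, 0 ≤ q i) (hm : 0 ≤ m)
    (hres : h + m • topMarginal q d h = f) {U : Set ι} (hf : MarginalsOrdered q d U f) :
    MarginalsOrdered q d U h := by
  intro N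
  induction N using Finset.strongInduction with
  | H N ih =>
    intro hNU a ha b hb hba
    have hN : N.Nonempty := ⟨a, ha⟩
    have key := marginal_cheapest_resolvent hd hres hN
    set t := cheapest d N hN with ht
    have htN : t ∈ N := cheapest_mem d hN
    have hmd : 0 ≤ m / d t := div_nonneg hm (hd t).le
    have hsub : ∀ j, (↑(N.erase j) : Set ι) ⊆ U := fun j x hx => hNU (Finset.mem_of_mem_erase hx)
    -- on smaller sets, all cheapest elements have the same marginal
    have top_eq : ∀ j ∈ N, j ≠ t →
        topMarginal q d h (N.erase j) = marginal q d t h (N.erase j) := by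
      intro j hj hjt
      have htj : t ∈ N.erase j := Finset.mem_erase.2 ⟨hjt.symm, htN⟩
      have hne : (N.erase j).Nonempty := ⟨t, htj⟩
      rw [topMarginal_apply q d h hne]
      have hc := cheapest_mem d hne
      exact le_antisymm
        (ih _ (Finset.erase_ssubset hj) (hsub j) _ hc _ htj
          (cheapest_le d hN (Finset.mem_of_mem_erase hc)))
        (ih _ (Finset.erase_ssubset hj) (hsub j) _ htj _ hc (cheapest_le d hne htj))
    have other : ∀ j ∈ N, j ≠ t → (1 + m / d t) * marginal q d j h N =
        marginal q d j f N + m / d t * (q t * marginal q d j h (N.erase t)) := by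
      intro j hj hjt
      have h1 : f N = h N + m * marginal q d t h N := by
        rw [← hres, Pi.add_apply, Pi.smul_apply, topMarginal_apply q d h hN, smul_eq_mul]
      have h2 : f (N.erase j) = h (N.erase j) + m * marginal q d t h (N.erase j) := by
        rw [← hres, Pi.add_apply, Pi.smul_apply, smul_eq_mul, top_eq j hj hjt]
      have h3 : marginal q d j f N =
          marginal q d j h N + m * marginal q d j (marginal q d t h) N := by
        simp only [marginal] at h1 h2 ⊢
        rw [h1, h2]
        ring
      have h4 : marginal q d j (marginal q d t h) N =
          (marginal q d j h N - q t * marginal q d j h (N.erase t)) / d t := by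
        rw [marginal_marginal]
        rfl
      rw [h3, h4]
      ring
    have hfab := hf N hNU a ha b hb hba
    have hc : 0 < 1 + m / d t := by positivity
    refine le_of_mul_le_mul_left ?_ hc
    by_cases hbt : b = t
    · by_cases hat : a = t
      · rw [hat, hbt]
      rw [other a ha hat, hbt, key]
      rw [hbt] at hfab
      have hat' : a ∈ N.erase t := Finset.mem_erase.2 ⟨hat, ha⟩
      have hne : (N.erase t).Nonempty := ⟨a, hat'⟩
      have : marginal q d a h (N.erase t) ≤ topMarginal q d h (N.erase t) := by
        rw [topMarginal_apply q d h hne]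
        exact ih _ (Finset.erase_ssubset htN) (hsub t) _ hat' _ (cheapest_mem d hne)
          (cheapest_le d hne hat')
      have := mul_le_mul_of_nonneg_left this (hq t)
      have := mul_le_mul_of_nonneg_left this hmd
      linarith
    · have hbt' : b ∈ N.erase t := Finset.mem_erase.2 ⟨hbt, hb⟩
      have hne : (N.erase t).Nonempty := ⟨b, hbt'⟩
      rw [other b hb hbt]
      by_cases hat : a = t
      · rw [hat, key]
        rw [hat] at hfab hba
        have : topMarginal q d h (N.erase t) ≤ marginal q d b h (N.erase t) := by
          rw [topMarginal_apply q d h hne]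
          exact ih _ (Finset.erase_ssubset htN) (hsub t) _ (cheapest_mem d hne) _ hbt'
            (hba.trans (cheapest_le d hN (Finset.mem_of_mem_erase (cheapest_mem d hne))))
        have := mul_le_mul_of_nonneg_left this (hq t)
        have := mul_le_mul_of_nonneg_left this hmd
        linarith
      · rw [other a ha hat]
        have := ih _ (Finset.erase_ssubset htN) (hsub t) _ (Finset.mem_erase.2 ⟨hat, ha⟩) _ hbt' hba
        have := mul_le_mul_of_nonneg_left this (hq t)
        have := mul_le_mul_of_nonneg_left this hmd
        linarith

/-- `1 + m D` is triangular with respect to inclusion, with nonzero diagonal. -/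
theorem one_add_smul_topMarginal_injective (hd : ∀ i, 0 < d i) (hm : 0 ≤ m) :
    Function.Injective (1 + m • topMarginal q d : Module.End ℝ (Finset ι → ℝ)) := by
  rw [← LinearMap.ker_eq_bot, LinearMap.ker_eq_bot']
  intro g hg
  have hg' : g + m • topMarginal q d g = 0 := by simpa using hg
  funext N
  induction N using Finset.strongInduction with
  | H N ih =>
    have := congrFun hg' N
    rcases N.eq_empty_or_nonempty with rfl | hN
    · simpa [topMarginal_empty] using this
    rw [Pi.add_apply, Pi.smul_apply, topMarginal_apply q d g hN, marginal,
      ih _ (Finset.erase_ssubset (cheapest_mem d hN))] at this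
    have hdt := hd (cheapest d N hN)
    have h2 : (1 + m / d (cheapest d N hN)) * g N = 0 := by
      simp only [Pi.zero_apply, mul_zero, sub_zero, smul_eq_mul] at this
      rw [← this]; ring
    exact (mul_eq_zero.1 h2).resolve_left (by positivity)

end Resolvent

open Polynomial in
/-- Applying `(1 + m D)⁻¹` for all positive means `m` to `W`, in any order: as polynomials in `D`
commute, removing any one of the factors gives the family member for the smaller set. -/
theorem exists_resolvent_family [Fintype ι] {q d : ι → ℝ} (hd : ∀ i, 0 < d i) {c : ι → ℝ}
    (hc : ∀ i, 0 ≤ c i) (W : Finset ι → ℝ) :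
    ∃ F : Finset ι → Finset ι → ℝ, F ∅ = W ∧
      ∀ P, ∀ i ∈ P, F P + c i • topMarginal q d (F P) = F (P.erase i) := by
  let A : Finset ι → Module.End ℝ (Finset ι → ℝ) := fun P =>
    aeval (topMarginal q d) (∏ i ∈ P, (1 + C (c i) * X : ℝ[X]))
  have hA : ∀ P, ∀ i ∈ P, A P = A (P.erase i) * (1 + c i • topMarginal q d) := by
    intro P i hi
    simp only [A]
    rw [← Finset.prod_erase_mul _ _ hi, map_mul]
    congr 1
    simp [Algebra.smul_def]
  have hinj : ∀ P, Function.Injective (A P) := by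
    intro P
    induction P using Finset.induction_on with
    | empty => simp only [A, Finset.prod_empty, map_one]; exact fun _ _ h => h
    | insert i P hi ih =>
      rw [hA _ i (Finset.mem_insert_self i P), Finset.erase_insert hi, Module.End.mul_eq_comp,
        LinearMap.coe_comp]
      exact ih.comp (one_add_smul_topMarginal_injective hd (hc i))
  have hsurj : ∀ P, Function.Surjective (A P) := fun P =>
    LinearMap.injective_iff_surjective.1 (hinj P)
  choose F hF using fun P => hsurj P W
  refine ⟨F, ?_, ?_⟩
  · have := hF ∅
    simpa [A] using this
  · intro P i hi
    apply hinj (P.erase i)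
    rw [hF, ← hF P, hA P i hi]
    rfl

/-- `L s` is the minimal expected loss of the policies that have found no positive reward yet and
have the arms `s` left; `q i` is the probability that arm `i` turns out to be nonpositive, and `W s`
the expected loss if none of the arms in `s` is ever explored. Exploring an arm `a` changes the
expected loss by at least `κ s * μ a`, where `κ s` is nonnegative, with equality for the arms that
OGP explores; hence a portfolio of nonnegative mean cannot decrease it. -/
structure IsLoss (μ q : ι → ℝ) (W L κ : Finset ι → ℝ) : Prop where
  nonneg : ∀ s, 0 ≤ κ s
  le : ∀ s, L s ≤ W s
  eq_of_forall_neg : ∀ s, (∀ i ∈ s, μ i < 0) → L s = W s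
  sub_of_pos : ∀ s, ∀ i ∈ s, 0 < μ i → q i * L (s.erase i) - L s = κ s * μ i
  le_sub_of_neg : ∀ s, ∀ j ∈ s, μ j < 0 → κ s * μ j ≤ q j * L (s.erase j) - L s
  sub_of_neg_max : ∀ s, ∀ j ∈ s, μ j < 0 → (∀ j' ∈ s, μ j' < 0 → μ j' ≤ μ j) →
    q j * L (s.erase j) - L s = κ s * μ j
  eq_zero : ∀ s, (∀ j ∈ s, ¬ μ j < 0) → κ s = 0

/-- The minimal loss exists: it is `(∏ q i) * F (N)`, where `i` ranges over the arms of positive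
mean in `s`, where `N` is the set of arms of negative mean in `s`, and where `F` arises from `W` by
applying the resolvents `(1 + μ i D)⁻¹`; moreover `κ s` is `(∏ q i) * (D F) (N)`. -/
theorem exists_isLoss [Fintype ι] {μ q : ι → ℝ} {W : Finset ι → ℝ} (hμ : ∀ i, μ i ≠ 0)
    (hq0 : ∀ i, 0 ≤ q i) (hq1 : ∀ i, q i ≤ 1) (hW0 : W ∅ = 0) (hWm : Monotone W)
    (hWswap : ∀ a b R, μ a < 0 → μ b < 0 → μ a ≤ μ b → a ∉ R → b ∉ R →
      W (insert a R) ≤ W (insert b R))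
    (hqswap : ∀ a b, μ a < 0 → μ b < 0 → μ a ≤ μ b → q b ≤ q a) :
    ∃ L κ : Finset ι → ℝ, IsLoss μ q W L κ := by
  classical
  set d : ι → ℝ := fun i => |μ i| with hd_def
  have hd : ∀ i, 0 < d i := fun i => abs_pos.2 (hμ i)
  have hdneg : ∀ i, μ i < 0 → d i = -μ i := fun i hi => abs_of_neg hi
  have hWnn : ∀ s, 0 ≤ W s := fun s => hW0 ▸ hWm (Finset.empty_subset s)
  set U : Set ι := {i | μ i < 0} with hU
  obtain ⟨F, hF0, hF⟩ := exists_resolvent_family (q := q) hd (c := d) (fun i => (hd i).le) W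
  have hgain : ∀ N a, 0 ≤ W N - q a * W (N.erase a) := by
    intro N a
    have h1 := hWm (Finset.erase_subset a N)
    have h2 := mul_le_mul_of_nonneg_right (hq1 a) (hWnn (N.erase a))
    simp only [one_mul] at h2
    linarith [show W (N.erase a) ≤ W N from h1]
  have hordW : MarginalsOrdered q d U W := by
    intro N hN a ha b hb hba
    have ha0 : μ a < 0 := hN ha
    have hb0 : μ b < 0 := hN hb
    have hab : μ a ≤ μ b := by
      rw [hdneg a ha0, hdneg b hb0] at hba; linarith
    have key : W N - q a * W (N.erase a) ≤ W N - q b * W (N.erase b) := by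
      rcases eq_or_ne a b with rfl | hne
      · exact le_rfl
      set R := (N.erase a).erase b with hR
      have h1 : N.erase a = insert b R :=
        (Finset.insert_erase (Finset.mem_erase.2 ⟨hne.symm, hb⟩)).symm
      have h2 : N.erase b = insert a R := by
        rw [hR, Finset.erase_right_comm]
        exact (Finset.insert_erase (Finset.mem_erase.2 ⟨hne, ha⟩)).symm
      rw [h1, h2]
      have h3 := hWswap a b R ha0 hb0 hab (by simp [hR]) (by simp [hR])
      have h4 := mul_le_mul_of_nonneg_right (hqswap a b ha0 hb0 hab) (hWnn (insert a R))
      have h5 := mul_le_mul_of_nonneg_left h3 (hq0 a)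
      linarith
    exact div_le_div₀ (hgain N b) key (hd b) hba
  have hnnW : ∀ N : Finset ι, (↑N : Set ι) ⊆ U → 0 ≤ topMarginal q d W N := by
    intro N _
    rcases N.eq_empty_or_nonempty with rfl | hN
    · rw [topMarginal_empty]
    · rw [topMarginal_apply q d W hN]
      exact div_nonneg (hgain _ _) (hd _).le
  have hord : ∀ P, MarginalsOrdered q d U (F P) := by
    intro P
    induction P using Finset.induction_on with
    | empty => rwa [hF0]
    | insert i P hi ih =>
      have := hF (insert i P) i (Finset.mem_insert_self i P)
      rw [Finset.erase_insert hi] at this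
      exact ih.resolvent hd hq0 (hd i).le this
  have hnn : ∀ P, ∀ N : Finset ι, (↑N : Set ι) ⊆ U → 0 ≤ topMarginal q d (F P) N := by
    intro P
    induction P using Finset.induction_on with
    | empty => rwa [hF0]
    | insert i P hi ih =>
      have := hF (insert i P) i (Finset.mem_insert_self i P)
      rw [Finset.erase_insert hi] at this
      exact topMarginal_resolvent_nonneg hd hq0 (hd i).le this ih
  have hFW : ∀ P, ∀ N : Finset ι, (↑N : Set ι) ⊆ U → F P N ≤ W N := by
    intro P N hN
    induction P using Finset.induction_on with
    | empty => rw [hF0]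
    | insert i P hi ih =>
      have := congrFun (hF (insert i P) i (Finset.mem_insert_self i P)) N
      rw [Finset.erase_insert hi, Pi.add_apply, Pi.smul_apply, smul_eq_mul] at this
      have := mul_nonneg (hd i).le (hnn (insert i P) N hN)
      linarith
  set p : Finset ι → Finset ι := fun s => s.filter fun i => 0 < μ i with hp
  set n : Finset ι → Finset ι := fun s => s.filter fun i => μ i < 0 with hn
  have hnU : ∀ s, (↑(n s) : Set ι) ⊆ U := fun s x hx => (Finset.mem_filter.1 hx).2
  set Q : Finset ι → ℝ := fun s => ∏ i ∈ p s, q i with hQ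
  have hQ0 : ∀ s, 0 ≤ Q s := fun s => Finset.prod_nonneg fun i _ => hq0 i
  have hQ1 : ∀ s, Q s ≤ 1 := fun s => Finset.prod_le_one (fun i _ => hq0 i) fun i _ => hq1 i
  -- removing an arm of negative mean
  have hneg : ∀ s, ∀ j ∈ s, μ j < 0 →
      q j * (Q (s.erase j) * F (p (s.erase j)) (n (s.erase j))) - Q s * F (p s) (n s) =
        Q s * marginal q d j (F (p s)) (n s) * μ j := by
    intro s j hj hj0
    have h1 : p (s.erase j) = p s := by
      simp only [hp]
      rw [Finset.filter_erase, Finset.erase_eq_of_notMem]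
      simp [hj0.not_gt]
    have h2 : n (s.erase j) = (n s).erase j := Finset.filter_erase _ _ _
    have h3 : Q (s.erase j) = Q s := by simp only [hQ, h1]
    rw [h1, h2, h3, marginal, hdneg j hj0]
    have := hj0.ne
    field_simp
    ring
  have hmem : ∀ s, ∀ j ∈ s, μ j < 0 → j ∈ n s := fun s j hj hj0 => Finset.mem_filter.2 ⟨hj, hj0⟩
  refine ⟨fun s => Q s * F (p s) (n s), fun s => Q s * topMarginal q d (F (p s)) (n s),
    ?_, ?_, ?_, ?_, ?_, ?_, ?_⟩
  · exact fun s => mul_nonneg (hQ0 s) (hnn _ _ (hnU s))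
  · intro s
    calc Q s * F (p s) (n s) ≤ Q s * W (n s) :=
          mul_le_mul_of_nonneg_left (hFW _ _ (hnU s)) (hQ0 s)
      _ ≤ 1 * W (n s) := mul_le_mul_of_nonneg_right (hQ1 s) (hWnn _)
      _ ≤ W s := by rw [one_mul]; exact hWm (Finset.filter_subset _ _)
  · intro s hs
    have h1 : p s = ∅ := Finset.filter_eq_empty_iff.2 fun {i} hi => (hs i hi).not_gt
    have h2 : n s = s := Finset.filter_true_of_mem hs
    simp only [hQ, h1, h2, hF0, Finset.prod_empty, one_mul]
  · intro s i hi hi0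
    have him : i ∈ p s := Finset.mem_filter.2 ⟨hi, hi0⟩
    have h1 : p (s.erase i) = (p s).erase i := Finset.filter_erase _ _ _
    have h2 : n (s.erase i) = n s := by
      simp only [hn]
      rw [Finset.filter_erase, Finset.erase_eq_of_notMem]
      simp [hi0.not_gt]
    have h3 : q i * Q (s.erase i) = Q s := by
      simp only [hQ, h1]
      exact Finset.mul_prod_erase _ _ him
    have h4 := congrFun (hF (p s) i him) (n s)
    have h5 : d i = μ i := abs_of_pos hi0
    simp only [Pi.add_apply, Pi.smul_apply, smul_eq_mul, h5] at h4
    rw [← mul_assoc, h3, h1, h2, ← h4]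
    ring
  · intro s j hj hj0
    rw [hneg s j hj hj0]
    have hne : (n s).Nonempty := ⟨j, hmem s j hj hj0⟩
    have := hord (p s) (n s) (hnU s) j (hmem s j hj hj0) _ (cheapest_mem d hne)
      (cheapest_le d hne (hmem s j hj hj0))
    rw [topMarginal_apply q d _ hne]
    exact mul_le_mul_of_nonpos_right (mul_le_mul_of_nonneg_left this (hQ0 s)) hj0.le
  · intro s j hj hj0 hmax
    rw [hneg s j hj hj0]
    have hjn := hmem s j hj hj0
    have hne : (n s).Nonempty := ⟨j, hjn⟩
    have hcm := cheapest_mem d hne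
    have hc := Finset.mem_filter.1 hcm
    rw [topMarginal_apply q d _ hne, le_antisymm
      (hord (p s) (n s) (hnU s) j hjn _ hcm (cheapest_le d hne hjn))
      (hord (p s) (n s) (hnU s) _ hcm j hjn
        (by rw [hdneg _ hj0, hdneg _ hc.2]; linarith [hmax _ hc.1 hc.2]))]
  · intro s hs
    have : n s = ∅ := Finset.filter_eq_empty_iff.2 fun {j} hj => hs j hj
    simp only [this, topMarginal_empty, mul_zero]

end Loss

/-! ### Stochastic dominance and the expected best reward -/

section Dominance

variable {Ω : Type*} {K : ℕ} {X : Fin K → Ω → ℝ}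

/-- The positive part of the highest reward of the arms in `s`. -/
def bestReward {K : ℕ} (s : Finset (Fin K)) (x : Fin K → ℝ) : ℝ := s.fold max 0 x

theorem bestReward_empty (x : Fin K → ℝ) : bestReward ∅ x = 0 := rfl

theorem bestReward_insert {a : Fin K} {s : Finset (Fin K)} (h : a ∉ s) (x : Fin K → ℝ) :
    bestReward (insert a s) x = max (x a) (bestReward s x) := Finset.fold_insert h

theorem bestReward_nonneg (s : Finset (Fin K)) (x : Fin K → ℝ) : 0 ≤ bestReward s x :=
  (Finset.le_fold_max 0).2 (Or.inl le_rfl)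

theorem le_bestReward {a : Fin K} {s : Finset (Fin K)} (h : a ∈ s) (x : Fin K → ℝ) :
    x a ≤ bestReward s x :=
  (Finset.le_fold_max _).2 (Or.inr ⟨a, h, le_rfl⟩)

theorem bestReward_le {s : Finset (Fin K)} {x : Fin K → ℝ} {c : ℝ} (hc : 0 ≤ c)
    (h : ∀ a ∈ s, x a ≤ c) : bestReward s x ≤ c :=
  (Finset.fold_max_le c).2 ⟨hc, h⟩

theorem bestReward_mono {s t : Finset (Fin K)} (h : s ⊆ t) (x : Fin K → ℝ) :
    bestReward s x ≤ bestReward t x :=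
  bestReward_le (bestReward_nonneg t x) fun _ ha => le_bestReward (h ha) x

theorem bestReward_le_sum_abs (s : Finset (Fin K)) (x : Fin K → ℝ) :
    bestReward s x ≤ ∑ i, |x i| :=
  bestReward_le (Finset.sum_nonneg fun i _ => abs_nonneg (x i)) fun a _ =>
    (le_abs_self (x a)).trans
      (Finset.single_le_sum (f := fun i => |x i|) (fun i _ => abs_nonneg (x i)) (Finset.mem_univ a))

/-- Arms of nonpositive reward do not matter for the best reward. -/
theorem bestReward_eq_of_nonpos {s t : Finset (Fin K)} (h : s ⊆ t) {x : Fin K → ℝ}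
    (hx : ∀ a ∈ t, a ∉ s → x a ≤ 0) : bestReward t x = bestReward s x := by
  refine le_antisymm (bestReward_le (bestReward_nonneg s x) fun a ha => ?_) (bestReward_mono h x)
  by_cases has : a ∈ s
  · exact le_bestReward has x
  · exact (hx a ha has).trans (bestReward_nonneg s x)

/-- The information contained in the rewards of the arms in `E`. -/
abbrev info (X : Fin K → Ω → ℝ) (E : Finset (Fin K)) : MeasurableSpace Ω :=
  ⨆ i ∈ (E : Set (Fin K)), MeasurableSpace.comap (X i) inferInstance

theorem info_mono {E T : Finset (Fin K)} (h : E ⊆ T) : info X E ≤ info X T :=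
  biSup_mono fun _ hi => h hi

theorem measurable_info {E : Finset (Fin K)} {i : Fin K} (h : i ∈ E) :
    Measurable[info X E] (X i) :=
  measurable_iff_comap_le.2
    (le_iSup₂_of_le (f := fun i (_ : i ∈ (E : Set (Fin K))) => MeasurableSpace.comap (X i) _) i h
      le_rfl)

theorem measurable_bestReward_info (s : Finset (Fin K)) :
    Measurable[info X s] fun ω => bestReward s fun i => X i ω := by
  induction s using Finset.induction_on with
  | empty => simp only [bestReward_empty]; exact measurable_const
  | insert a s h ih =>
    simp only [bestReward_insert h]
    exact (measurable_info (Finset.mem_insert_self a s)).max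
      (ih.mono (info_mono (Finset.subset_insert a s)) le_rfl)

variable [MeasurableSpace Ω] {P : Measure Ω}

theorem info_le (hX : ∀ i, Measurable (X i)) (E : Finset (Fin K)) :
    info X E ≤ (inferInstance : MeasurableSpace Ω) :=
  iSup₂_le fun i _ => (hX i).comap_le

theorem measurable_bestReward (hX : ∀ i, Measurable (X i)) (s : Finset (Fin K)) :
    Measurable fun ω => bestReward s fun i => X i ω :=
  (measurable_bestReward_info s).mono (info_le hX s) le_rfl

theorem integrable_sum_abs (hint : ∀ i, Integrable (X i) P) :
    Integrable (fun ω => ∑ i, |X i ω|) P :=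
  integrable_finsetSum _ fun i _ => (hint i).abs

theorem integrable_bestReward (hX : ∀ i, Measurable (X i)) (hint : ∀ i, Integrable (X i) P)
    (s : Finset (Fin K)) : Integrable (fun ω => bestReward s fun i => X i ω) P := by
  refine (integrable_sum_abs hint).mono' (measurable_bestReward hX s).aestronglyMeasurable
    (Eventually.of_forall fun ω => ?_)
  rw [Real.norm_of_nonneg (bestReward_nonneg _ _)]
  exact bestReward_le_sum_abs _ _

/-- Functions of the rewards of disjoint sets of arms are independent. -/
theorem indepFun_info (hX : ∀ i, Measurable (X i)) (hindep : iIndepFun X P)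
    {E T : Finset (Fin K)} (hd : Disjoint E T) {f g : Ω → ℝ} (hf : Measurable[info X E] f)
    (hg : Measurable[info X T] g) : IndepFun f g P := by
  rw [IndepFun_iff_Indep]
  exact indep_of_indep_of_le_left (indep_of_indep_of_le_right
    (indep_iSup_of_disjoint (fun i => (hX i).comap_le) hindep.iIndep
      (Finset.disjoint_coe.2 hd)) hg.comap_le) hf.comap_le

theorem integral_mul_info (hX : ∀ i, Measurable (X i)) (hindep : iIndepFun X P)
    {E T : Finset (Fin K)} (hd : Disjoint E T) {f g : Ω → ℝ} (hf : Measurable[info X E] f)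
    (hg : Measurable[info X T] g) : ∫ ω, f ω * g ω ∂P = (∫ ω, f ω ∂P) * ∫ ω, g ω ∂P :=
  (indepFun_info hX hindep hd hf hg).integral_fun_mul_eq_mul_integral
    (hf.mono (info_le hX E) le_rfl).aestronglyMeasurable
    (hg.mono (info_le hX T) le_rfl).aestronglyMeasurable

/-- Dominance of `Y` over `Z` as far as positive rewards are concerned. -/
def TailDominates (P : Measure Ω) (Y Z : Ω → ℝ) : Prop :=
  ∀ᵐ c ∂volume.restrict (Set.Ioi (0 : ℝ)), P {ω | c ≤ Z ω} ≤ P {ω | c ≤ Y ω}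

theorem TailDominates.measure_pos_le {Y Z : Ω → ℝ} (h : TailDominates P Y Z) :
    P {ω | 0 < Z ω} ≤ P {ω | 0 < Y ω} := by
  have key : ∀ n : ℕ, P {ω | (1 : ℝ) / (n + 1) ≤ Z ω} ≤ P {ω | 0 < Y ω} := by
    intro n
    have hn : (0 : ℝ) < 1 / (n + 1) := by positivity
    -- a threshold below `1 / (n + 1)` at which the tails are ordered
    have hne : (volume.restrict (Set.Ioi (0 : ℝ))) (Set.Ioo 0 (1 / ((n : ℝ) + 1))) ≠ 0 := by
      rw [Measure.restrict_apply measurableSet_Ioo,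
        Set.inter_eq_left.2 Set.Ioo_subset_Ioi_self, Real.volume_Ioo]
      simpa using hn
    obtain ⟨c, hc, hcle⟩ : ∃ c, c ∈ Set.Ioo (0 : ℝ) (1 / ((n : ℝ) + 1)) ∧
        P {ω | c ≤ Z ω} ≤ P {ω | c ≤ Y ω} := by
      by_contra! hcon
      refine hne (measure_mono_null (fun c hc => ?_) (ae_iff.1 h))
      exact not_le.2 (hcon c hc)
    calc P {ω | (1 : ℝ) / (n + 1) ≤ Z ω} ≤ P {ω | c ≤ Z ω} :=
          measure_mono fun ω hω => hc.2.le.trans hω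
      _ ≤ P {ω | c ≤ Y ω} := hcle
      _ ≤ P {ω | 0 < Y ω} := measure_mono fun ω hω => hc.1.trans_le hω
  have hun : {ω | 0 < Z ω} = ⋃ n : ℕ, {ω | (1 : ℝ) / (n + 1) ≤ Z ω} := by
    ext ω
    simp only [Set.mem_ofPred_eq, Set.mem_iUnion]
    constructor
    · intro hω
      obtain ⟨n, hn⟩ := exists_nat_one_div_lt hω
      exact ⟨n, hn.le⟩
    · rintro ⟨n, hn⟩
      exact lt_of_lt_of_le (by positivity) hn
  have hmono : Monotone fun n : ℕ => {ω | (1 : ℝ) / (n + 1) ≤ Z ω} := by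
    intro n m hnm ω hω
    have hnm' : (n : ℝ) + 1 ≤ (m : ℝ) + 1 := by exact_mod_cast Nat.add_le_add_right hnm 1
    have hω' : (1 : ℝ) / (n + 1) ≤ Z ω := hω
    exact (one_div_le_one_div_of_le (by positivity) hnm').trans hω'
  rw [hun, hmono.measure_iUnion]
  exact iSup_le key

theorem lintegral_posPart_eq {Y : Ω → ℝ} (hY : Measurable Y) :
    ∫⁻ ω, ENNReal.ofReal (Y ω) ∂P = ∫⁻ c in Set.Ioi (0 : ℝ), P {ω | c ≤ Y ω} := by
  have h := lintegral_eq_lintegral_meas_le P (f := fun ω => max (Y ω) 0)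
    (Eventually.of_forall fun ω => le_max_right _ _) (hY.max measurable_const).aemeasurable
  simp only [ENNReal.ofReal_max, ENNReal.ofReal_zero, zero_le, max_eq_left] at h
  rw [h]
  refine setLIntegral_congr_fun measurableSet_Ioi fun c hc => ?_
  have hc' : ¬ c ≤ 0 := not_le.2 hc
  simp [hc']

/-- If `Y` dominates `Z` but has no larger mean, then conversely `Z` dominates `Y` on the positive
half line. -/
theorem StochDominates.tailDominates_symm [IsProbabilityMeasure P] {Y Z : Ω → ℝ}
    (hYm : Measurable Y) (hZm : Measurable Z)
    (hY : Integrable Y P) (hZ : Integrable Z P) (h : StochDominates P Y Z)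
    (hle : ∫ ω, Y ω ∂P ≤ ∫ ω, Z ω ∂P) : TailDominates P Z Y := by
  have hpos : ∫⁻ ω, ENNReal.ofReal (Z ω) ∂P ≤ ∫⁻ ω, ENNReal.ofReal (Y ω) ∂P := by
    rw [lintegral_posPart_eq hYm, lintegral_posPart_eq hZm]
    exact lintegral_mono fun c => h c
  have hneg : ∫⁻ ω, ENNReal.ofReal (-Y ω) ∂P ≤ ∫⁻ ω, ENNReal.ofReal (-Z ω) ∂P := by
    rw [lintegral_posPart_eq (Y := fun ω => -Y ω) hYm.neg,
      lintegral_posPart_eq (Y := fun ω => -Z ω) hZm.neg]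
    refine lintegral_mono_ae ?_
    have hcount := fun W : Ω → ℝ =>
      meas_le_ae_eq_meas_lt P (volume.restrict (Set.Ioi (0 : ℝ))) W
    filter_upwards [hcount (fun ω => -Y ω), hcount (fun ω => -Z ω)] with c h1 h2
    rw [h1, h2]
    have hc : ∀ W : Ω → ℝ, {ω | c < -W ω} = {ω | -c ≤ W ω}ᶜ := by
      intro W; ext ω; simp only [Set.mem_ofPred_eq, Set.mem_compl_iff, not_le]; constructor <;>
        intro _ <;> linarith
    rw [hc, hc, prob_compl_eq_one_sub (measurableSet_le measurable_const hYm),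
      prob_compl_eq_one_sub (measurableSet_le measurable_const hZm)]
    exact tsub_le_tsub_left (h (-c)) 1
  have hYp := hY.lintegral_lt_top.ne
  have hZn : ∫⁻ ω, ENNReal.ofReal (-Z ω) ∂P ≠ ⊤ := hZ.neg.lintegral_lt_top.ne
  rw [integral_eq_lintegral_pos_part_sub_lintegral_neg_part hY,
    integral_eq_lintegral_pos_part_sub_lintegral_neg_part hZ] at hle
  have h1 := ENNReal.toReal_mono hZn hneg
  have h2 : ∫⁻ ω, ENNReal.ofReal (Y ω) ∂P ≤ ∫⁻ ω, ENNReal.ofReal (Z ω) ∂P := by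
    rw [← ENNReal.toReal_le_toReal hYp (ne_top_of_le_ne_top hYp hpos)]
    linarith
  rw [lintegral_posPart_eq hYm] at h2 hYp
  rw [lintegral_posPart_eq hZm] at h2
  have hanti : ∀ {W : Ω → ℝ}, Measurable fun c : ℝ => P {ω | c ≤ W ω} := fun {W} =>
    Antitone.measurable fun c c' hcc => measure_mono fun ω hω => hcc.trans hω
  have := ae_eq_of_ae_le_of_lintegral_le (μ := volume.restrict (Set.Ioi (0 : ℝ)))
    (f := fun c => P {ω | c ≤ Z ω}) (g := fun c => P {ω | c ≤ Y ω})
    (Eventually.of_forall fun c => h c) (ne_top_of_le_ne_top hYp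
      (lintegral_mono fun c => h c)) hanti.aemeasurable h2
  filter_upwards [this] with c hc
  exact hc.ge

/-- Among the arms of negative mean, an arm of higher mean has higher positive rewards. In case of
equal means this holds in both directions. -/
theorem NegStochOrdered.tailDominates [IsProbabilityMeasure P] (hX : ∀ i, Measurable (X i))
    (hint : ∀ i, Integrable (X i) P) (hord : NegStochOrdered P X) {a b : Fin K}
    (ha : mean P X a < 0) (hb : mean P X b < 0) (hab : mean P X a ≤ mean P X b) :
    TailDominates P (X b) (X a) := by
  rcases hord a b ha hb with h | h
  · exact h.tailDominates_symm (hX a) (hX b) (hint a) (hint b) hab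
  · exact Eventually.of_forall fun c => h c

/-- Replacing an arm by a dominating one increases the expected best reward. -/
theorem TailDominates.integral_bestReward_insert_le [IsProbabilityMeasure P]
    (hX : ∀ i, Measurable (X i)) (hint : ∀ i, Integrable (X i) P) (hindep : iIndepFun X P)
    {a b : Fin K} (h : TailDominates P (X b) (X a)) {R : Finset (Fin K)} (ha : a ∉ R)
    (hb : b ∉ R) :
    ∫ ω, bestReward (insert a R) (fun i => X i ω) ∂P ≤
      ∫ ω, bestReward (insert b R) (fun i => X i ω) ∂P := by
  have hrep : ∀ s : Finset (Fin K), ∫ ω, bestReward s (fun i => X i ω) ∂P =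
      (∫⁻ ω, ENNReal.ofReal (bestReward s fun i => X i ω) ∂P).toReal := fun s =>
    integral_eq_lintegral_of_nonneg_ae (Eventually.of_forall fun ω => bestReward_nonneg _ _)
      (measurable_bestReward hX s).aestronglyMeasurable
  rw [hrep, hrep]
  refine ENNReal.toReal_mono (integrable_bestReward hX hint _).lintegral_lt_top.ne ?_
  rw [lintegral_posPart_eq (measurable_bestReward hX _),
    lintegral_posPart_eq (measurable_bestReward hX _)]
  refine lintegral_mono_ae ?_
  filter_upwards [h] with c hc
  have hprod : ∀ e ∉ R, P {ω | c ≤ bestReward (insert e R) fun i => X i ω} =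
      1 - (1 - P {ω | c ≤ X e ω}) * P {ω | bestReward R (fun i => X i ω) < c} := by
    intro e he
    have hind := indepFun_info hX hindep (E := {e}) (T := R) (by simpa using he)
      (measurable_info (X := X) (Finset.mem_singleton_self e)) (measurable_bestReward_info R)
    have h1 := hind.measure_inter_preimage_eq_mul (Set.Iio c) (Set.Iio c) measurableSet_Iio
      measurableSet_Iio
    have h2 : {ω | c ≤ bestReward (insert e R) fun i => X i ω} =
        (X e ⁻¹' Set.Iio c ∩ (fun ω => bestReward R fun i => X i ω) ⁻¹' Set.Iio c)ᶜ := by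
      ext ω
      simp only [Set.mem_ofPred_eq, bestReward_insert he, Set.mem_compl_iff, Set.mem_inter_iff,
        Set.mem_preimage, Set.mem_Iio, ← max_lt_iff, not_lt]
    have h3 : X e ⁻¹' Set.Iio c = {ω | c ≤ X e ω}ᶜ := by
      ext ω; simp
    rw [h2, prob_compl_eq_one_sub ((hX e measurableSet_Iio).inter
      (measurable_bestReward hX R measurableSet_Iio)), h1, h3,
      prob_compl_eq_one_sub (measurableSet_le measurable_const (hX e))]
    rfl
  rw [hprod a ha, hprod b hb]
  gcongr

theorem exists_isLoss_of_negStochOrdered [IsProbabilityMeasure P]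
    (hX : ∀ i, Measurable (X i)) (hint : ∀ i, Integrable (X i) P) (hindep : iIndepFun X P)
    (hmean : ∀ i, mean P X i ≠ 0) (hord : NegStochOrdered P X) :
    ∃ L κ : Finset (Fin K) → ℝ, IsLoss (mean P X) (fun i => P.real {ω | X i ω ≤ 0})
      (fun s => ∫ ω, bestReward s (fun i => X i ω) ∂P) L κ := by
  refine exists_isLoss hmean (fun i => measureReal_nonneg) (fun i => measureReal_le_one)
    (by simp [bestReward_empty]) (fun s t hst => ?_) (fun a b R ha hb hab haR hbR => ?_)
    (fun a b ha hb hab => ?_)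
  · exact integral_mono (integrable_bestReward hX hint s) (integrable_bestReward hX hint t)
      fun ω => bestReward_mono hst _
  · exact (hord.tailDominates hX hint ha hb hab).integral_bestReward_insert_le hX hint hindep haR
      hbR
  · have h := (hord.tailDominates hX hint ha hb hab).measure_pos_le
    have hc : ∀ i, {ω | X i ω ≤ 0} = {ω | 0 < X i ω}ᶜ := fun i => by ext ω; simp
    have hm : ∀ i, MeasurableSet {ω | 0 < X i ω} := fun i =>
      measurableSet_lt measurable_const (hX i)
    simp only [hc, probReal_compl_eq_one_sub (hm _)]
    exact sub_le_sub_left (ENNReal.toReal_mono (measure_ne_top P _) h) 1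

end Dominance

/-! ### Histories as functions of the rewards -/

section Histories

variable {K : ℕ}

/-- The history that results from the selection of the arms `as` if the reward vector is `x`. -/
def hist (as : List (Option (Fin K))) (x : Fin K → ℝ) : History K :=
  as.map fun a => (a, reward x a)

/-- The arms of `A` that occur in `as`. -/
def seen (as : List (Option (Fin K))) : Finset (Fin K) :=
  Finset.univ.filter fun i => some i ∈ as

/-- The arms of `A` that do not occur in `as`. -/
def unseen (as : List (Option (Fin K))) : Finset (Fin K) := (seen as)ᶜ

theorem mem_seen {as : List (Option (Fin K))} {i : Fin K} : i ∈ seen as ↔ some i ∈ as := by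
  simp [seen]

theorem mem_unseen {as : List (Option (Fin K))} {i : Fin K} : i ∈ unseen as ↔ some i ∉ as := by
  simp [unseen, mem_seen]

theorem hist_append (as : List (Option (Fin K))) (a : Option (Fin K)) (x : Fin K → ℝ) :
    hist (as ++ [a]) x = hist as x ++ [(a, reward x a)] := by simp [hist]

theorem explored_hist (as : List (Option (Fin K))) (x : Fin K → ℝ) :
    explored (hist as x) = seen as := by
  simp [explored, seen, hist, Function.comp_def]

theorem unexplored_hist (as : List (Option (Fin K))) (x : Fin K → ℝ) :
    unexplored (hist as x) = unseen as := by
  rw [unexplored, explored_hist, unseen]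

theorem seen_append_subset (as : List (Option (Fin K))) (a : Option (Fin K)) :
    seen as ⊆ seen (as ++ [a]) := fun i hi => by
  rw [mem_seen] at hi ⊢
  exact List.mem_append_left _ hi

theorem unseen_append_some (as : List (Option (Fin K))) (i : Fin K) :
    unseen (as ++ [some i]) = (unseen as).erase i := by
  ext j
  simp only [mem_unseen, Finset.mem_erase, List.mem_append, List.mem_singleton, Option.some.injEq,
    not_or]
  tauto

theorem unseen_append_of_seen {as : List (Option (Fin K))} {i : Fin K} (h : i ∉ unseen as) :
    unseen (as ++ [some i]) = unseen as := by
  rw [unseen_append_some, Finset.erase_eq_of_notMem h]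

theorem unseen_append_none (as : List (Option (Fin K))) :
    unseen (as ++ [none]) = unseen as := by
  ext j
  simp [mem_unseen]

theorem condMean_of_mem_unseen {μ : Fin K → ℝ} {as : List (Option (Fin K))} {x : Fin K → ℝ}
    {i : Fin K} (h : i ∈ unseen as) : condMean μ (hist as x) (some i) = μ i := by
  have : (hist as x).find? (fun e => decide (e.1 = some i)) = none := by
    rw [List.find?_eq_none]
    intro e he
    obtain ⟨a, ha, rfl⟩ := List.mem_map.1 he
    simp only [decide_eq_true_eq]
    rintro rfl
    exact mem_unseen.1 h ha
  simp [condMean, this]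

theorem condMean_of_mem_seen {μ : Fin K → ℝ} {as : List (Option (Fin K))} {x : Fin K → ℝ}
    {i : Fin K} (h : some i ∈ as) : condMean μ (hist as x) (some i) = x i := by
  obtain ⟨e, he⟩ : ∃ e, (hist as x).find? (fun e => decide (e.1 = some i)) = some e := by
    rw [← Option.isSome_iff_exists, List.find?_isSome]
    exact ⟨(some i, reward x (some i)), List.mem_map.2 ⟨some i, h, rfl⟩, by simp⟩
  have h1 := List.find?_some he
  obtain ⟨a, -, rfl⟩ := List.mem_map.1 (List.mem_of_find?_eq_some he)
  simp only [decide_eq_true_eq] at h1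
  simp [condMean, he, h1, reward]

theorem Possible.exists_hist {M : Strategy K} {h : History K} (hp : Possible M h) :
    ∃ as x, h = hist as x := by
  obtain ⟨x, hx⟩ := hp.1
  refine ⟨h.map Prod.fst, x, ?_⟩
  simp only [hist, List.map_map]
  conv_lhs => rw [← List.map_id h]
  refine List.map_congr_left fun e he => ?_
  exact Prod.ext rfl (hx e he)

theorem possible_nil (M : Strategy K) : Possible M [] := by
  refine ⟨⟨0, by simp⟩, fun g e hg => ?_⟩
  simp at hg

theorem Possible.append {M : Strategy K} {as : List (Option (Fin K))} {x : Fin K → ℝ}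
    (h : Possible M (hist as x)) {a : Option (Fin K)} (ha : 0 < M (hist as x) a) :
    Possible M (hist (as ++ [a]) x) := by
  refine ⟨⟨x, fun e he => ?_⟩, fun g e hg => ?_⟩
  · obtain ⟨b, -, rfl⟩ := List.mem_map.1 he
    rfl
  · rw [hist_append, List.prefix_concat_iff] at hg
    rcases hg with hg | hg
    · obtain ⟨rfl, h2⟩ := List.append_inj' hg rfl
      simp only [List.cons.injEq, and_true] at h2
      rwa [h2]
    · exact h.2 g e hg

theorem abs_reward_le (x : Fin K → ℝ) (a : Option (Fin K)) : |reward x a| ≤ ∑ i, |x i| := by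
  cases a with
  | none => simpa [reward] using Finset.sum_nonneg fun i _ => abs_nonneg (x i)
  | some i =>
    exact Finset.single_le_sum (f := fun i => |x i|) (fun i _ => abs_nonneg (x i))
      (Finset.mem_univ i)

theorem IsMechanism.le_one {M : Strategy K} (hM : IsMechanism M) (h : History K)
    (a : Option (Fin K)) : M h a ≤ 1 := by
  rw [← hM.sum_eq_one h]
  exact Finset.single_le_sum (fun b _ => hM.nonneg h b) (Finset.mem_univ a)

theorem abs_totalReward_le {M : Strategy K} (hM : IsMechanism M) (x : Fin K → ℝ) (n : ℕ)
    (h : History K) : |totalReward M x n h| ≤ n * ∑ i, |x i| := by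
  induction n generalizing h with
  | zero => simp [totalReward]
  | succ n ih =>
    calc |totalReward M x (n + 1) h|
        ≤ ∑ a, M h a * ((n + 1 : ℕ) * ∑ i, |x i|) := by
          refine (Finset.abs_sum_le_sum_abs _ _).trans (Finset.sum_le_sum fun a _ => ?_)
          rw [abs_mul, abs_of_nonneg (hM.nonneg h a)]
          refine mul_le_mul_of_nonneg_left ((abs_add_le _ _).trans ?_) (hM.nonneg h a)
          push_cast
          linarith [abs_reward_le x a, ih (h ++ [(a, reward x a)])]
      _ = _ := by rw [← Finset.sum_mul, hM.sum_eq_one, one_mul]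

end Histories

/-! ### Optimality of OGP: an upper bound for all MIR mechanisms -/

section UpperBound

variable {Ω : Type*} {K : ℕ} {X : Fin K → Ω → ℝ} {M : Strategy K}

theorem measurable_reward_info {E : Finset (Fin K)} {a : Option (Fin K)}
    (h : ∀ i, a = some i → i ∈ E) :
    Measurable[info X E] fun ω => reward (fun i => X i ω) a := by
  cases a with
  | none => exact measurable_const
  | some i => exact measurable_info (h i rfl)

theorem measurable_strategy_info (hM : IsMechanism M) (as : List (Option (Fin K)))
    (b : Option (Fin K)) :
    Measurable[info X (seen as)] fun ω => M (hist as fun i => X i ω) b := by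
  have h : ∀ x : Fin K → ℝ, hist as x =
      List.ofFn fun t : Fin as.length => (as.get t, reward x (as.get t)) := by
    intro x
    conv_lhs => rw [← List.ofFn_get as]
    rw [hist, List.map_ofFn]
    rfl
  simp only [h]
  refine (hM.measurable as.length as.get b).comp ?_
  refine @measurable_pi_lambda _ _ _ (info X (seen as)) _ _ fun t => ?_
  refine measurable_reward_info fun i hi => ?_
  rw [mem_seen, ← hi]
  exact List.get_mem _ _

/-- The indicator of the event that none of the arms `as` has positive reward. -/
noncomputable def failed (as : List (Option (Fin K))) (x : Fin K → ℝ) : ℝ :=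
  open Classical in if ∀ a ∈ as, reward x a ≤ 0 then 1 else 0

theorem failed_eq_one {as : List (Option (Fin K))} {x : Fin K → ℝ}
    (h : ∀ a ∈ as, reward x a ≤ 0) : failed as x = 1 := if_pos h

theorem failed_eq_zero {as : List (Option (Fin K))} {x : Fin K → ℝ}
    (h : ¬ ∀ a ∈ as, reward x a ≤ 0) : failed as x = 0 := if_neg h

theorem failed_nonneg (as : List (Option (Fin K))) (x : Fin K → ℝ) : 0 ≤ failed as x := by
  unfold failed; split_ifs <;> norm_num

theorem failed_le_one (as : List (Option (Fin K))) (x : Fin K → ℝ) : failed as x ≤ 1 := by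
  unfold failed; split_ifs <;> norm_num

theorem failed_append_of_imp {as : List (Option (Fin K))} {a : Option (Fin K)} {x : Fin K → ℝ}
    (h : (∀ b ∈ as, reward x b ≤ 0) → reward x a ≤ 0) :
    failed (as ++ [a]) x = failed as x := by
  unfold failed
  congr 1
  simp only [List.mem_append, List.mem_singleton, eq_iff_iff]
  constructor
  · exact fun H b hb => H b (Or.inl hb)
  · rintro H b (hb | rfl)
    · exact H b hb
    · exact h H

theorem failed_append (as : List (Option (Fin K))) (a : Option (Fin K)) (x : Fin K → ℝ) :
    failed (as ++ [a]) x = failed as x * (Set.Iic (0 : ℝ)).indicator 1 (reward x a) := by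
  by_cases h : ∀ b ∈ as, reward x b ≤ 0
  · by_cases ha : reward x a ≤ 0
    · rw [failed_append_of_imp fun _ => ha, Set.indicator_of_mem (Set.mem_Iic.2 ha)]
      simp
    · rw [failed_eq_zero fun H => ha (H a (by simp)), Set.indicator_of_notMem (by simpa using ha),
        mul_zero]
  · rw [failed_eq_zero h, failed_eq_zero fun H => h fun b hb => H b (by simp [hb]), zero_mul]

theorem measurable_failed_info (as : List (Option (Fin K))) :
    Measurable[info X (seen as)] fun ω => failed as fun i => X i ω := by
  induction as using List.reverseRecOn with
  | nil => simp [failed]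
  | append_singleton as a ih =>
    simp only [failed_append]
    refine Measurable.mul (ih.mono (info_mono (seen_append_subset as a)) le_rfl) ?_
    exact (measurable_one.indicator measurableSet_Iic).comp
      (measurable_reward_info fun i hi => by simp [mem_seen, hi])

/-- After failure, the best reward is that of the unexplored arms. -/
theorem failed_mul_bestReward (as : List (Option (Fin K))) (x : Fin K → ℝ) :
    failed as x * bestReward Finset.univ x = failed as x * bestReward (unseen as) x := by
  by_cases h : ∀ a ∈ as, reward x a ≤ 0
  · rw [bestReward_eq_of_nonpos (Finset.subset_univ (unseen as))]
    intro i _ hi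
    rw [mem_unseen, not_not] at hi
    exact h _ hi
  · rw [failed_eq_zero h, zero_mul, zero_mul]

/-- A weight is a function of the rewards of the arms `as` that vanishes where the mechanism would
not select the arms `as`. It plays the role of an event in the information at the time when `as`
have been selected, together with the probability of the selections. -/
structure IsWeight (M : Strategy K) (X : Fin K → Ω → ℝ) (as : List (Option (Fin K))) (w : Ω → ℝ) :
    Prop where
  nonneg : ∀ ω, 0 ≤ w ω
  le_one : ∀ ω, w ω ≤ 1
  measurable : Measurable[info X (seen as)] w
  possible : ∀ ω, w ω ≠ 0 → Possible M (hist as fun i => X i ω)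

theorem isWeight_one (M : Strategy K) (X : Fin K → Ω → ℝ) : IsWeight M X [] fun _ => 1 :=
  ⟨fun _ => zero_le_one, fun _ => le_rfl, measurable_const, fun _ _ => possible_nil M⟩

theorem IsWeight.append (hM : IsMechanism M) {as : List (Option (Fin K))} {w : Ω → ℝ}
    (hw : IsWeight M X as w) (a : Option (Fin K)) :
    IsWeight M X (as ++ [a]) fun ω => w ω * M (hist as fun i => X i ω) a where
  nonneg ω := mul_nonneg (hw.nonneg ω) (hM.nonneg _ _)
  le_one ω := mul_le_one₀ (hw.le_one ω) (hM.nonneg _ _) (hM.le_one _ _)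
  measurable := (hw.measurable.mul (measurable_strategy_info hM as a)).mono
    (info_mono (seen_append_subset as a)) le_rfl
  possible ω h := (hw.possible ω (left_ne_zero_of_mul h)).append
    ((hM.nonneg _ _).lt_of_ne' (right_ne_zero_of_mul h))

variable [MeasurableSpace Ω] {P : Measure Ω}

theorem measurable_totalReward (hX : ∀ i, Measurable (X i)) (hM : IsMechanism M) (n : ℕ)
    (as : List (Option (Fin K))) :
    Measurable fun ω => totalReward M (fun i => X i ω) n (hist as fun i => X i ω) := by
  induction n generalizing as with
  | zero => exact measurable_const
  | succ n ih =>
    simp only [totalReward, ← hist_append]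
    refine Finset.measurable_fun_sum _ fun a _ => ?_
    refine ((measurable_strategy_info hM as a).mono (info_le hX _) le_rfl).mul
      (Measurable.add ?_ (ih _))
    exact (measurable_reward_info (E := Finset.univ) fun i _ => Finset.mem_univ i).mono
      (info_le hX _) le_rfl

theorem IsWeight.measurable' (hX : ∀ i, Measurable (X i)) {as : List (Option (Fin K))} {w : Ω → ℝ}
    (hw : IsWeight M X as w) : Measurable w := hw.measurable.mono (info_le hX _) le_rfl

theorem IsWeight.integrable_mul (hX : ∀ i, Measurable (X i)) {as : List (Option (Fin K))}
    {w : Ω → ℝ} (hw : IsWeight M X as w) {f : Ω → ℝ} (hf : Integrable f P) :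
    Integrable (fun ω => w ω * f ω) P := by
  refine hf.bdd_mul (c := 1) (hw.measurable' hX).aestronglyMeasurable
    (Eventually.of_forall fun ω => ?_)
  rw [Real.norm_of_nonneg (hw.nonneg ω)]
  exact hw.le_one ω

theorem integrable_totalReward (hX : ∀ i, Measurable (X i)) (hint : ∀ i, Integrable (X i) P)
    (hM : IsMechanism M) (n : ℕ) (as : List (Option (Fin K))) :
    Integrable (fun ω => totalReward M (fun i => X i ω) n (hist as fun i => X i ω)) P :=
  ((integrable_sum_abs hint).const_mul (n : ℝ)).mono'
    (measurable_totalReward hX hM n as).aestronglyMeasurable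
    (Eventually.of_forall fun _ => abs_totalReward_le hM _ _ _)

theorem integrable_reward (hint : ∀ i, Integrable (X i) P) (a : Option (Fin K)) :
    Integrable (fun ω => reward (fun i => X i ω) a) P := by
  cases a with
  | none => exact integrable_zero _ _ _
  | some i => exact hint i

theorem integrable_failed [IsProbabilityMeasure P] (hX : ∀ i, Measurable (X i))
    (as : List (Option (Fin K))) : Integrable (fun ω => failed as fun i => X i ω) P :=
  (integrable_const (1 : ℝ)).mono'
    ((measurable_failed_info as).mono (info_le hX _) le_rfl).aestronglyMeasurable
    (Eventually.of_forall fun ω => by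
      rw [Real.norm_of_nonneg (failed_nonneg _ _)]; exact failed_le_one _ _)

/-- The expected total reward in the following rounds, as a sum over the next arm. -/
theorem integral_weight_totalReward_succ (hX : ∀ i, Measurable (X i))
    (hint : ∀ i, Integrable (X i) P) (hM : IsMechanism M) {as : List (Option (Fin K))} {w : Ω → ℝ}
    (hw : IsWeight M X as w) (n : ℕ) :
    ∫ ω, w ω * totalReward M (fun i => X i ω) (n + 1) (hist as fun i => X i ω) ∂P =
      ∑ a, (∫ ω, w ω * M (hist as fun i => X i ω) a * reward (fun i => X i ω) a ∂P +
        ∫ ω, w ω * M (hist as fun i => X i ω) a *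
          totalReward M (fun i => X i ω) n (hist (as ++ [a]) fun i => X i ω) ∂P) := by
  have h1 := fun a => (hw.append hM a).integrable_mul hX (integrable_reward hint a)
  have h2 := fun a => (hw.append hM a).integrable_mul hX
    (integrable_totalReward hX hint hM n (as ++ [a]))
  simp only [← fun a => integral_add (h1 a) (h2 a)]
  rw [← integral_finsetSum _ fun a _ => (h1 a).fun_add (h2 a)]
  congr 1
  funext ω
  simp only [totalReward, Finset.mul_sum, hist_append]
  refine Finset.sum_congr rfl fun a _ => ?_
  ring

/-- The expected loss after `a` is selected, if no positive reward was found before and `s` is the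
set of unexplored arms. -/
def nextLoss (q : Fin K → ℝ) (L : Finset (Fin K) → ℝ) (s : Finset (Fin K)) : Option (Fin K) → ℝ
  | none => L s
  | some i => if i ∈ s then q i * L (s.erase i) else L s

/-- The potential of a history: the best reward, minus the expected loss if no positive reward has
been found yet. -/
noncomputable def potential (L : Finset (Fin K) → ℝ) (as : List (Option (Fin K)))
    (x : Fin K → ℝ) : ℝ :=
  bestReward Finset.univ x - failed as x * L (unseen as)

theorem integrable_potential [IsProbabilityMeasure P] (hX : ∀ i, Measurable (X i))
    (hint : ∀ i, Integrable (X i) P) (L : Finset (Fin K) → ℝ) (as : List (Option (Fin K))) :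
    Integrable (fun ω => potential L as fun i => X i ω) P :=
  (integrable_bestReward hX hint _).sub ((integrable_failed hX as).mul_const _)

theorem integrable_failed_mul_nextLoss [IsProbabilityMeasure P] (hX : ∀ i, Measurable (X i))
    (hM : IsMechanism M) (q : Fin K → ℝ) (L : Finset (Fin K) → ℝ) (as : List (Option (Fin K))) :
    Integrable (fun ω => failed as (fun i => X i ω) *
      ∑ a, M (hist as fun i => X i ω) a * nextLoss q L (unseen as) a) P := by
  have h : ∀ a, Integrable (fun ω => M (hist as fun i => X i ω) a *
      (failed as (fun i => X i ω) * nextLoss q L (unseen as) a)) P := by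
    intro a
    refine ((integrable_failed hX as).mul_const _).bdd_mul (c := 1)
      ((measurable_strategy_info hM as a).mono (info_le hX _) le_rfl).aestronglyMeasurable
      (Eventually.of_forall fun ω => ?_)
    rw [Real.norm_of_nonneg (hM.nonneg _ _)]
    exact hM.le_one _ _
  refine (integrable_finsetSum Finset.univ fun a _ => h a).congr (Eventually.of_forall fun ω => ?_)
  simp only [Finset.mul_sum]
  exact Finset.sum_congr rfl fun a _ => by ring

theorem integral_mul_failed_append [IsProbabilityMeasure P] (hX : ∀ i, Measurable (X i))
    (hindep : iIndepFun X P) (L : Finset (Fin K) → ℝ) {as : List (Option (Fin K))} {w : Ω → ℝ}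
    (hw : Measurable[info X (seen as)] w) (a : Option (Fin K)) :
    ∫ ω, w ω * (failed (as ++ [a]) (fun i => X i ω) * L (unseen (as ++ [a]))) ∂P =
      ∫ ω, w ω * (failed as (fun i => X i ω) *
        nextLoss (fun i => P.real {ω | X i ω ≤ 0}) L (unseen as) a) ∂P := by
  cases a with
  | none =>
    simp only [unseen_append_none, nextLoss]
    congr 1; funext ω
    rw [failed_append_of_imp fun _ => le_rfl]
  | some i =>
    by_cases hi : i ∈ unseen as
    · simp only [nextLoss, hi, if_true, unseen_append_some, failed_append]
      have hd : Disjoint (seen as) {i} := by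
        rw [Finset.disjoint_singleton_right, mem_seen]
        exact mem_unseen.1 hi
      have key := integral_mul_info hX hindep hd (hw.mul (measurable_failed_info as))
        ((measurable_one.indicator (measurableSet_Iic (a := (0 : ℝ)))).comp
          (measurable_info (X := X) (Finset.mem_singleton_self i)))
      have hq : ∫ ω, ((Set.Iic (0 : ℝ)).indicator (1 : ℝ → ℝ) ∘ X i) ω ∂P =
          P.real {ω | X i ω ≤ 0} := by
        exact integral_indicator_one (s := {ω | X i ω ≤ 0}) (hX i measurableSet_Iic)
      rw [hq] at key
      calc _ = (∫ ω, (w ω * failed as (fun i => X i ω)) *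
            ((Set.Iic (0 : ℝ)).indicator (1 : ℝ → ℝ) ∘ X i) ω ∂P) * L ((unseen as).erase i) := by
            rw [← integral_mul_const]
            congr 1; funext ω
            simp only [reward, Function.comp]
            ring
        _ = _ := by
            refine (congrArg (· * L ((unseen as).erase i)) key).trans ?_
            rw [mul_assoc, ← integral_mul_const]
            congr 1; funext ω
            simp only [Pi.mul_apply]
            ring
    · simp only [nextLoss, hi, if_false, unseen_append_of_seen hi]
      congr 1; funext ω
      rw [failed_append_of_imp fun h => h _ (not_not.1 (mt mem_unseen.2 hi))]

theorem integral_mul_failed_bestReward [IsProbabilityMeasure P] (hX : ∀ i, Measurable (X i))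
    (hindep : iIndepFun X P) {as : List (Option (Fin K))} {w : Ω → ℝ}
    (hw : Measurable[info X (seen as)] w) :
    ∫ ω, w ω * (failed as (fun i => X i ω) * bestReward Finset.univ (fun i => X i ω)) ∂P =
      ∫ ω, w ω * (failed as (fun i => X i ω) *
        ∫ ω', bestReward (unseen as) (fun i => X i ω') ∂P) ∂P := by
  simp only [failed_mul_bestReward, ← mul_assoc]
  rw [integral_mul_const]
  exact integral_mul_info hX hindep disjoint_compl_right
    (hw.mul (measurable_failed_info as)) (measurable_bestReward_info (unseen as))

/-- The expected potential after the next selection. -/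
theorem sum_integral_potential_append [IsProbabilityMeasure P] (hX : ∀ i, Measurable (X i))
    (hint : ∀ i, Integrable (X i) P) (hindep : iIndepFun X P) (hM : IsMechanism M)
    (L : Finset (Fin K) → ℝ) {as : List (Option (Fin K))} {w : Ω → ℝ} (hw : IsWeight M X as w) :
    ∑ a, ∫ ω, w ω * M (hist as fun i => X i ω) a * potential L (as ++ [a]) (fun i => X i ω) ∂P =
      ∫ ω, w ω * (bestReward Finset.univ (fun i => X i ω) - failed as (fun i => X i ω) *
        ∑ a, M (hist as fun i => X i ω) a *
          nextLoss (fun i => P.real {ω | X i ω ≤ 0}) L (unseen as) a) ∂P := by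
  have h1 := fun a => (hw.append hM a).integrable_mul hX
    (integrable_bestReward hX hint Finset.univ)
  have h2 := fun a => (hw.append hM a).integrable_mul hX
    ((integrable_failed hX (P := P) (as ++ [a])).mul_const (L (unseen (as ++ [a]))))
  have h3 := fun a => (hw.append hM a).integrable_mul hX
    ((integrable_failed hX (P := P) as).mul_const
      (nextLoss (fun i => P.real {ω | X i ω ≤ 0}) L (unseen as) a))
  have h4 : ∀ a, ∫ ω, w ω * M (hist as fun i => X i ω) a *
      potential L (as ++ [a]) (fun i => X i ω) ∂P =
      ∫ ω, (w ω * M (hist as fun i => X i ω) a * bestReward Finset.univ (fun i => X i ω) -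
        w ω * M (hist as fun i => X i ω) a * (failed as (fun i => X i ω) *
          nextLoss (fun i => P.real {ω | X i ω ≤ 0}) L (unseen as) a)) ∂P := by
    intro a
    simp only [potential, mul_sub]
    rw [integral_sub (h1 a) (h2 a), integral_sub (h1 a) (h3 a)]
    congr 1
    exact integral_mul_failed_append hX hindep L
      (hw.measurable.mul (measurable_strategy_info hM as a)) a
  simp only [h4]
  have h5 : ∀ a, Integrable (fun ω =>
      w ω * M (hist as fun i => X i ω) a * bestReward Finset.univ (fun i => X i ω) -
        w ω * M (hist as fun i => X i ω) a * (failed as (fun i => X i ω) *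
          nextLoss (fun i => P.real {ω | X i ω ≤ 0}) L (unseen as) a)) P :=
    fun a => (h1 a).sub (h3 a)
  rw [← integral_finsetSum _ fun a _ => h5 a]
  congr 1; funext ω
  rw [Finset.sum_sub_distrib, ← Finset.sum_mul, ← Finset.mul_sum, hM.sum_eq_one, Finset.mul_sum,
    mul_sub, Finset.mul_sum]
  congr 1
  · ring
  · exact Finset.sum_congr rfl fun a _ => by ring

/-- While no positive reward has been found, no portfolio of nonnegative expected reward decreases
the expected loss. -/
theorem IsLoss.le_sum_nextLoss {μ q : Fin K → ℝ} {W L κ : Finset (Fin K) → ℝ}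
    (hL : IsLoss μ q W L κ) (hμ : ∀ i, μ i ≠ 0) {as : List (Option (Fin K))} {x : Fin K → ℝ}
    (hx : ∀ a ∈ as, reward x a ≤ 0) {p : Option (Fin K) → ℝ} (hp : ∀ a, 0 ≤ p a)
    (hp1 : ∑ a, p a = 1) (hmir : 0 ≤ ∑ a, p a * condMean μ (hist as x) a) :
    L (unseen as) ≤ ∑ a, p a * nextLoss q L (unseen as) a := by
  have key : ∀ a, κ (unseen as) * condMean μ (hist as x) a ≤
      nextLoss q L (unseen as) a - L (unseen as) := by
    intro a
    cases a with
    | none => simp [condMean, nextLoss]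
    | some i =>
      by_cases hi : i ∈ unseen as
      · rw [condMean_of_mem_unseen hi]
        simp only [nextLoss, hi, if_true]
        rcases lt_or_gt_of_ne (hμ i) with h | h
        · exact hL.le_sub_of_neg _ i hi h
        · exact (hL.sub_of_pos _ i hi h).ge
      · have hi' : some i ∈ as := not_not.1 (mt mem_unseen.2 hi)
        rw [condMean_of_mem_seen hi']
        simp only [nextLoss, hi, if_false, sub_self]
        exact mul_nonpos_of_nonneg_of_nonpos (hL.nonneg _) (hx _ hi')
  have h1 : ∑ a, p a * (κ (unseen as) * condMean μ (hist as x) a) ≤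
      ∑ a, p a * (nextLoss q L (unseen as) a - L (unseen as)) :=
    Finset.sum_le_sum fun a _ => mul_le_mul_of_nonneg_left (key a) (hp a)
  have h2 : ∑ a, p a * (κ (unseen as) * condMean μ (hist as x) a) =
      κ (unseen as) * ∑ a, p a * condMean μ (hist as x) a := by
    rw [Finset.mul_sum]
    exact Finset.sum_congr rfl fun a _ => by ring
  simp only [mul_sub] at h1
  rw [Finset.sum_sub_distrib, ← Finset.sum_mul, hp1, one_mul, h2] at h1
  linarith [mul_nonneg (hL.nonneg (unseen as)) hmir]

/-- The reward of a round is at most the potential after the round, in expectation. -/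
theorem integral_weight_reward_le_potential [IsProbabilityMeasure P] (hX : ∀ i, Measurable (X i))
    (hint : ∀ i, Integrable (X i) P) (hindep : iIndepFun X P) {μ q : Fin K → ℝ}
    {L κ : Finset (Fin K) → ℝ}
    (hL : IsLoss μ q (fun s => ∫ ω, bestReward s (fun i => X i ω) ∂P) L κ)
    {as : List (Option (Fin K))} {w : Ω → ℝ} (hw : IsWeight M X as w) {a : Option (Fin K)}
    (ha : a ∈ as) :
    ∫ ω, w ω * reward (fun i => X i ω) a ∂P ≤ ∫ ω, w ω * potential L as (fun i => X i ω) ∂P := by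
  have hB := integrable_bestReward hX hint (P := P) Finset.univ
  have hF := integrable_failed hX (P := P) as
  have hfB : Integrable (fun ω => failed as (fun i => X i ω) *
      bestReward Finset.univ (fun i => X i ω)) P := by
    refine hB.bdd_mul (c := 1) hF.1 (Eventually.of_forall fun ω => ?_)
    rw [Real.norm_of_nonneg (failed_nonneg _ _)]
    exact failed_le_one _ _
  have hpt : ∀ ω, w ω * reward (fun i => X i ω) a ≤
      w ω * bestReward Finset.univ (fun i => X i ω) -
        w ω * (failed as (fun i => X i ω) * bestReward Finset.univ (fun i => X i ω)) := by
    intro ω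
    rw [← mul_sub]
    refine mul_le_mul_of_nonneg_left ?_ (hw.nonneg ω)
    by_cases h : ∀ b ∈ as, reward (fun i => X i ω) b ≤ 0
    · rw [failed_eq_one h]
      linarith [h a ha]
    · rw [failed_eq_zero h, zero_mul, sub_zero]
      cases a with
      | none => exact bestReward_nonneg _ _
      | some i => exact le_bestReward (x := fun i => X i ω) (Finset.mem_univ i)
  refine (integral_mono (hw.integrable_mul hX (integrable_reward hint a))
    ((hw.integrable_mul hX hB).sub (hw.integrable_mul hX hfB)) hpt).trans ?_
  simp only [Pi.sub_apply, potential, mul_sub]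
  rw [integral_sub (hw.integrable_mul hX hB) (hw.integrable_mul hX hfB),
    integral_sub (hw.integrable_mul hX hB) (hw.integrable_mul hX (hF.mul_const _)),
    integral_mul_failed_bestReward hX hindep hw.measurable]
  refine sub_le_sub_left (integral_mono (hw.integrable_mul hX (hF.mul_const _))
    (hw.integrable_mul hX (hF.mul_const _)) fun ω => ?_) _
  exact mul_le_mul_of_nonneg_left (mul_le_mul_of_nonneg_left (hL.le _) (failed_nonneg _ _))
    (hw.nonneg ω)

/-- For MIR mechanisms the potential is a supermartingale that bounds the reward of every round. -/
theorem integral_weight_totalReward_le [IsProbabilityMeasure P] (hX : ∀ i, Measurable (X i))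
    (hint : ∀ i, Integrable (X i) P) (hindep : iIndepFun X P) (hmean : ∀ i, mean P X i ≠ 0)
    {L κ : Finset (Fin K) → ℝ} (hL : IsLoss (mean P X) (fun i => P.real {ω | X i ω ≤ 0})
      (fun s => ∫ ω, bestReward s (fun i => X i ω) ∂P) L κ)
    (hM : IsMechanism M) (hmir : IsMIR (mean P X) M) (n : ℕ) {as : List (Option (Fin K))}
    {w : Ω → ℝ} (hw : IsWeight M X as w) :
    ∫ ω, w ω * totalReward M (fun i => X i ω) n (hist as fun i => X i ω) ∂P ≤
      n * ∫ ω, w ω * potential L as (fun i => X i ω) ∂P := by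
  induction n generalizing as w with
  | zero => simp [totalReward]
  | succ n ih =>
    rw [integral_weight_totalReward_succ hX hint hM hw]
    calc _ ≤ ∑ a, (((n : ℝ) + 1) * ∫ ω, w ω * M (hist as fun i => X i ω) a *
            potential L (as ++ [a]) (fun i => X i ω) ∂P) := by
          refine Finset.sum_le_sum fun a _ => ?_
          have h1 := integral_weight_reward_le_potential hX hint hindep hL (hw.append hM a)
            (a := a) (by simp)
          have h2 := ih (hw.append hM a)
          linarith
      _ ≤ _ := by
          rw [← Finset.mul_sum]
          push_cast
          refine mul_le_mul_of_nonneg_left ?_ (by positivity)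
          have hI := hw.integrable_mul hX (integrable_potential hX hint (P := P) L as)
          rw [sum_integral_potential_append hX hint hindep hM L hw]
          refine integral_mono (hw.integrable_mul hX ((integrable_bestReward hX hint _).sub
            (integrable_failed_mul_nextLoss hX hM _ _ as))) hI fun ω => ?_
          by_cases hw0 : w ω = 0
          · simp [hw0]
          refine mul_le_mul_of_nonneg_left (sub_le_sub_left ?_ _) (hw.nonneg ω)
          by_cases h : ∀ b ∈ as, reward (fun i => X i ω) b ≤ 0
          · rw [failed_eq_one h, one_mul, one_mul]
            exact hL.le_sum_nextLoss hmean h (hM.nonneg _) (hM.sum_eq_one _)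
              (hmir _ (hw.possible ω hw0))
          · rw [failed_eq_zero h, zero_mul, zero_mul]

end UpperBound

/-! ### Executions of IREGB -/

section Executions

variable {K : ℕ} {μ : Fin K → ℝ}

theorem terminal_iff {s : Finset (Fin K)} : Terminal μ s ↔ ∀ i ∈ s, μ i < 0 := by
  constructor
  · intro h i hi
    by_contra! hi0
    have : (fun a => if a = i then (1 : ℝ) else 0) ∈ MIRSet μ s := by
      refine ⟨fun a => by positivity, fun a ha => if_neg ?_, ?_, ?_⟩
      · rintro rfl
        exact ha hi
      · rw [Finset.sum_ite_eq' s i fun _ => (1 : ℝ), if_pos hi]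
      · simp only [ite_mul, one_mul, zero_mul]
        rwa [Finset.sum_ite_eq' s i μ, if_pos hi]
    rw [Terminal] at h
    rw [h] at this
    exact this
  · intro h
    rw [Terminal, Set.eq_empty_iff_forall_notMem]
    rintro p ⟨hp, -, h1, h2⟩
    have h3 : ∀ a ∈ s, p a * μ a ≤ 0 := fun a ha =>
      mul_nonpos_of_nonneg_of_nonpos (hp a) (h a ha).le
    have h4 : ∑ a ∈ s, p a * μ a = 0 := le_antisymm (Finset.sum_nonpos h3) h2
    rw [Finset.sum_eq_zero_iff_of_nonpos h3] at h4
    rw [Finset.sum_eq_zero fun a ha => (mul_eq_zero.1 (h4 a ha)).resolve_right (h a ha).ne] at h1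
    exact zero_ne_one h1

theorem Terminal.mono {s t : Finset (Fin K)} (h : Terminal μ t) (hst : s ⊆ t) : Terminal μ s :=
  terminal_iff.2 fun i hi => terminal_iff.1 h i (hst hi)

theorem unexplored_anti {g h : History K} (hg : g <+: h) : unexplored h ⊆ unexplored g := by
  obtain ⟨t, rfl⟩ := hg
  intro i
  simp only [unexplored, explored, Finset.mem_compl, Finset.mem_filter, Finset.mem_univ, true_and,
    List.map_append, List.mem_append, not_or]
  exact And.left

theorem IsExplorationPart.terminal {h g : History K} (hg : IsExplorationPart μ h g) :
    Terminal μ (unexplored h) := hg.2.1.mono (unexplored_anti hg.1)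

theorem IsExplorationPart.unique {h g g' : History K} (hg : IsExplorationPart μ h g)
    (hg' : IsExplorationPart μ h g') : g = g' := by
  by_contra hne
  rcases List.prefix_or_prefix_of_prefix hg.1 hg'.1 with h1 | h1
  · exact hg'.2.2 g h1 hne hg.2.1
  · exact hg.2.2 g' h1 (Ne.symm hne) hg'.2.1

theorem IsExplorationPart.of_prefix {h h' g : History K} (hg : IsExplorationPart μ h g)
    (hh : h <+: h') : IsExplorationPart μ h' g := ⟨hg.1.trans hh, hg.2⟩

theorem sum_pick_mul (a : Option (Fin K)) (f : Option (Fin K) → ℝ) :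
    ∑ c, pick a c * f c = f a := by
  simp [pick]

theorem sum_mix_mul {i j : Fin K} (hij : i ≠ j) (v w : ℝ) (f : Option (Fin K) → ℝ) :
    ∑ c, mix i v j w c * f c = -w / (v - w) * f (some i) + v / (v - w) * f (some j) := by
  have h : ∀ c, mix i v j w c * f c = (if c = some i then -w / (v - w) * f (some i) else 0) +
      (if c = some j then v / (v - w) * f (some j) else 0) := by
    intro c
    have hij' : (some i : Option (Fin K)) ≠ some j := fun h => hij (Option.some.inj h)
    unfold mix
    split_ifs with h1 h2 h2
    · exact absurd (h1.symm.trans h2) hij'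
    · rw [h1, add_zero]
    · rw [h2, zero_add]
    · rw [zero_mul, add_zero]
  simp only [h, Finset.sum_add_distrib, Finset.sum_ite_eq', Finset.mem_univ, if_true]

/-- The mix of `i` and `j` has expected value zero. -/
theorem sum_mix_mul_eq_zero {i j : Fin K} (hij : i ≠ j) {v w : ℝ} {f : Option (Fin K) → ℝ}
    (hi : f (some i) = v) (hj : f (some j) = w) : ∑ c, mix i v j w c * f c = 0 := by
  rw [sum_mix_mul hij, hi, hj]
  ring

theorem eq_of_mem_hist {as : List (Option (Fin K))} {x : Fin K → ℝ} {i : Fin K} {y : ℝ}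
    (h : (some i, y) ∈ hist as x) : some i ∈ as ∧ y = x i := by
  obtain ⟨a, ha, hay⟩ := List.mem_map.1 h
  simp only [Prod.mk.injEq] at hay
  obtain ⟨rfl, rfl⟩ := hay
  exact ⟨ha, rfl⟩

theorem isMIR_of_isIREGB {M : Strategy K} (hM : IsIREGB μ M) : IsMIR μ M := by
  intro h hp
  obtain ⟨as, x, rfl⟩ := hp.exists_hist
  have hmove := hM _ hp
  generalize M (hist as x) = p at hmove
  cases hmove with
  | ogpMix i j hs hi hi0 hj hj0 hmax =>
    rw [unexplored_hist] at hi hj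
    refine (sum_mix_mul_eq_zero ?_ (condMean_of_mem_unseen hi) (condMean_of_mem_unseen hj)).ge
    rintro rfl
    exact hi0.not_gt hj0
  | ogpSingle i hs hi hi0 hneg =>
    rw [unexplored_hist] at hi
    rw [sum_pick_mul, condMean_of_mem_unseen hi]
    exact hi0.le
  | trial g k j y hg hk hy hmax hj =>
    rw [unexplored_hist] at hj
    obtain ⟨hk1, rfl⟩ := eq_of_mem_hist (hg.1.subset hk)
    refine (sum_mix_mul_eq_zero ?_ (condMean_of_mem_seen hk1) (condMean_of_mem_unseen hj)).ge
    rintro rfl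
    exact mem_unseen.1 hj hk1
  | exploit g k y hg hpos hall hk hmax =>
    obtain ⟨hk1, rfl⟩ := eq_of_mem_hist hk
    obtain ⟨e, he, he0⟩ := hpos
    rw [sum_pick_mul, condMean_of_mem_seen hk1]
    exact he0.le.trans (hmax e (hg.1.subset he))
  | giveUp g hg hnonpos =>
    rw [sum_pick_mul]
    exact le_rfl

theorem totalReward_le {M : Strategy K} (hM : IsMechanism M) (x : Fin K → ℝ) (n : ℕ)
    (h : History K) : totalReward M x n h ≤ n * bestReward Finset.univ x := by
  induction n generalizing h with
  | zero => simp [totalReward]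
  | succ n ih =>
    calc totalReward M x (n + 1) h
        ≤ ∑ a, M h a * ((n + 1 : ℕ) * bestReward Finset.univ x) := by
          refine Finset.sum_le_sum fun a _ => mul_le_mul_of_nonneg_left ?_ (hM.nonneg h a)
          have h1 : reward x a ≤ bestReward Finset.univ x := by
            cases a with
            | none => exact bestReward_nonneg _ _
            | some i => exact le_bestReward (Finset.mem_univ i) x
          push_cast
          linarith [ih (h ++ [(a, reward x a)])]
      _ = _ := by rw [← Finset.sum_mul, hM.sum_eq_one, one_mul]

/-- A bound for the expected loss of the Bernoulli trials per arm that is explored by them. -/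
noncomputable def trialCost (μ x : Fin K → ℝ) : ℝ :=
  ∑ i, if 0 < x i then 2 * (∑ k, |x k|) * ((x i + ∑ k, |μ k|) / x i) else 0

theorem trialCost_term_nonneg (μ x : Fin K → ℝ) (i : Fin K) :
    0 ≤ if 0 < x i then 2 * (∑ k, |x k|) * ((x i + ∑ k, |μ k|) / x i) else 0 := by
  split_ifs with h
  · have := Finset.sum_nonneg fun (k : Fin K) (_ : k ∈ Finset.univ) => abs_nonneg (x k)
    have := Finset.sum_nonneg fun (k : Fin K) (_ : k ∈ Finset.univ) => abs_nonneg (μ k)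
    positivity
  · exact le_rfl

theorem trialCost_nonneg (μ x : Fin K → ℝ) : 0 ≤ trialCost μ x :=
  Finset.sum_nonneg fun i _ => trialCost_term_nonneg μ x i

/-- A trial with the arm `j` explores it with probability `x k / (x k - μ j)`. -/
theorem two_mul_le_trialCost {x : Fin K → ℝ} {k : Fin K} (hk : 0 < x k) {j : Fin K}
    (hj : μ j < 0) : 2 * ∑ i, |x i| ≤ x k / (x k - μ j) * trialCost μ x := by
  have h1 := Finset.single_le_sum (fun i _ => trialCost_term_nonneg μ x i) (Finset.mem_univ k)
  rw [if_pos hk] at h1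
  have h2 : -μ j ≤ ∑ i, |μ i| := (neg_le_abs _).trans
    (Finset.single_le_sum (f := fun i => |μ i|) (fun i _ => abs_nonneg (μ i)) (Finset.mem_univ j))
  have hS := Finset.sum_nonneg fun (k : Fin K) (_ : k ∈ Finset.univ) => abs_nonneg (x k)
  have hpos : 0 < x k - μ j := by linarith
  calc 2 * ∑ i, |x i| = x k / (x k - μ j) * (2 * (∑ i, |x i|) * ((x k - μ j) / x k)) := by
        field_simp
    _ ≤ x k / (x k - μ j) * (2 * (∑ i, |x i|) * ((x k + ∑ i, |μ i|) / x k)) := by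
        gcongr
        linarith
    _ ≤ _ := by
        gcongr
        exact h1

/-- Once the unexplored arms are terminal and a positive reward has been found, the expected total
loss compared to the best arm stays bounded. -/
theorem regret_le {M : Strategy K} (hM : IsIREGB μ M) (x : Fin K → ℝ)
    {g : History K} (hpos : ∃ e ∈ g, 0 < e.2) (n : ℕ) {as : List (Option (Fin K))}
    (hp : Possible M (hist as x)) (hg : IsExplorationPart μ (hist as x) g) :
    n * bestReward Finset.univ x - totalReward M x n (hist as x) ≤
      (unseen as).card * trialCost μ x := by
  have hC := trialCost_nonneg μ x
  induction n generalizing as with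
  | zero =>
    simp only [totalReward, Nat.cast_zero, zero_mul, sub_zero]
    positivity
  | succ n ih =>
    have hext : ∀ a, 0 < M (hist as x) a → n * bestReward Finset.univ x -
        totalReward M x n (hist as x ++ [(a, reward x a)]) ≤
          (unseen (as ++ [a])).card * trialCost μ x := by
      intro a ha
      rw [← hist_append]
      refine ih (hp.append ha) (hg.of_prefix ?_)
      rw [hist_append]
      exact List.prefix_append _ _
    have hmove := hM _ hp
    rw [totalReward]
    generalize M (hist as x) = p at hmove hext
    cases hmove with
    | ogpMix i j hs => exact absurd hg.terminal hs
    | ogpSingle i hs => exact absurd hg.terminal hs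
    | giveUp g' hg' hnonpos =>
      obtain ⟨e, he, he0⟩ := hpos
      exact absurd (hnonpos e (hg.unique hg' ▸ he)) he0.not_ge
    | exploit g' k y hg' hpos' hall hk hmax =>
      obtain ⟨hk1, rfl⟩ := eq_of_mem_hist hk
      rw [unexplored_hist] at hall
      rw [sum_pick_mul]
      have h1 := hext (some k) (by simp [pick])
      have hB : bestReward Finset.univ x ≤ x k := by
        obtain ⟨e, he, he0⟩ := hpos
        refine bestReward_le (he0.le.trans (hmax e (hg.1.subset he))) fun a _ => ?_
        have ha : some a ∈ as := by
          by_contra ha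
          have := mem_unseen.2 ha
          rw [hall] at this
          exact absurd this (Finset.notMem_empty a)
        exact hmax _ (List.mem_map.2 ⟨some a, ha, rfl⟩)
      rw [unseen_append_of_seen (by simp [hall])] at h1
      push_cast
      simp only [reward] at h1 ⊢
      linarith
    | trial g' k j y hg' hk hy hmax hj =>
      rw [unexplored_hist] at hj
      obtain ⟨hk1, rfl⟩ := eq_of_mem_hist (hg'.1.subset hk)
      have hkj : k ≠ j := by
        rintro rfl
        exact mem_unseen.1 hj hk1
      have hj0 : μ j < 0 := by
        have := hg.terminal
        rw [unexplored_hist] at this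
        exact terminal_iff.1 this j hj
      have hden : 0 < x k - μ j := by linarith
      have hpk : 0 < -μ j / (x k - μ j) := div_pos (by linarith) hden
      have hpj : 0 < x k / (x k - μ j) := div_pos hy hden
      have hsum : -μ j / (x k - μ j) + x k / (x k - μ j) = 1 := by
        field_simp
        ring
      rw [sum_mix_mul hkj]
      have h1 := hext (some k) (by simpa [mix] using hpk)
      have h2 := hext (some j) (by simpa [mix, Ne.symm hkj] using hpj)
      rw [unseen_append_of_seen (fun h => mem_unseen.1 h hk1)] at h1
      have hcard : ((unseen (as ++ [some j])).card : ℝ) = (unseen as).card - 1 := by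
        rw [unseen_append_some, Finset.card_erase_of_mem hj,
          Nat.cast_sub (Finset.card_pos.2 ⟨j, hj⟩), Nat.cast_one]
      rw [hcard] at h2
      have hB := bestReward_le_sum_abs Finset.univ x
      have h3 := two_mul_le_trialCost hy hj0
      have h4 := neg_le_of_abs_le (abs_reward_le x (some k))
      have h5 := neg_le_of_abs_le (abs_reward_le x (some j))
      generalize hpk' : -μ j / (x k - μ j) = pk at *
      generalize hpj' : x k / (x k - μ j) = pj at *
      set B := bestReward Finset.univ x
      set S := ∑ i, |x i|
      have h6 : pk * ((n : ℝ) * B + B - (reward x (some k) + totalReward M x n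
          (hist as x ++ [(some k, reward x (some k))]))) ≤
          pk * (2 * S + (unseen as).card * trialCost μ x) :=
        mul_le_mul_of_nonneg_left (by linarith) hpk.le
      have h7 : pj * ((n : ℝ) * B + B - (reward x (some j) + totalReward M x n
          (hist as x ++ [(some j, reward x (some j))]))) ≤
          pj * (2 * S + ((unseen as).card - 1) * trialCost μ x) :=
        mul_le_mul_of_nonneg_left (by linarith) hpj.le
      have hpk1 : pk = 1 - pj := by linarith
      subst hpk1
      push_cast
      linarith

/-- If no positive reward has been found when the unexplored arms become terminal, then only the
default arm is selected. -/
theorem totalReward_eq_zero {M : Strategy K} (hM : IsIREGB μ M) (x : Fin K → ℝ)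
    {g : History K} (hneg : ∀ e ∈ g, e.2 ≤ 0) (n : ℕ) {as : List (Option (Fin K))}
    (hp : Possible M (hist as x)) (hg : IsExplorationPart μ (hist as x) g) :
    totalReward M x n (hist as x) = 0 := by
  induction n generalizing as with
  | zero => rfl
  | succ n ih =>
    have hmove : M (hist as x) = pick none := by
      have hmove := hM _ hp
      generalize M (hist as x) = p at hmove
      cases hmove with
      | ogpMix i j hs => exact absurd hg.terminal hs
      | ogpSingle i hs => exact absurd hg.terminal hs
      | giveUp g' hg' hnonpos => rfl
      | exploit g' k y hg' hpos' hall hk hmax =>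
        obtain ⟨e, he, he0⟩ := hpos'
        exact absurd (hneg e (hg'.unique hg ▸ he)) he0.not_ge
      | trial g' k j y hg' hk hy hmax hj =>
        exact absurd (hneg _ (hg'.unique hg ▸ hk)) hy.not_ge
    have hpn := hp.append (a := none) (by simp [hmove, pick])
    rw [totalReward, hmove, sum_pick_mul, ← hist_append, ih hpn (hg.of_prefix ?_)]
    · simp [reward]
    · rw [hist_append]
      exact List.prefix_append _ _

/-- While the unexplored arms are not terminal, only unexplored arms are selected. -/
theorem IREGBMove.mem_unexplored {h : History K} {p : Option (Fin K) → ℝ}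
    (hmove : IREGBMove μ h p) (hs : ¬ Terminal μ (unexplored h)) {a : Option (Fin K)}
    (ha : p a ≠ 0) : ∃ i ∈ unexplored h, a = some i := by
  cases hmove with
  | ogpMix i j _ hi hi0 hj =>
    unfold mix at ha
    split_ifs at ha with h1 h2
    · exact ⟨i, hi, h1⟩
    · exact ⟨j, hj, h2⟩
    · exact absurd rfl ha
  | ogpSingle i _ hi =>
    unfold pick at ha
    split_ifs at ha with h1
    · exact ⟨i, hi, h1⟩
    · exact absurd rfl ha
  | trial g _ _ _ hg => exact absurd hg.terminal hs
  | exploit g _ _ hg => exact absurd hg.terminal hs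
  | giveUp g hg => exact absurd hg.terminal hs

/-- The moves of OGP keep the expected loss constant. -/
theorem IREGBMove.sum_nextLoss {q : Fin K → ℝ} {W L κ : Finset (Fin K) → ℝ}
    (hL : IsLoss μ q W L κ) {h : History K} {p : Option (Fin K) → ℝ}
    (hmove : IREGBMove μ h p) (hs : ¬ Terminal μ (unexplored h)) :
    ∑ a, p a * nextLoss q L (unexplored h) a = L (unexplored h) := by
  cases hmove with
  | ogpMix i j _ hi hi0 hj hj0 hmax =>
    rw [sum_mix_mul fun h => (h ▸ hi0).not_gt hj0]
    simp only [nextLoss, hi, hj, if_true]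
    have h1 := hL.sub_of_pos _ i hi hi0
    have h2 := hL.sub_of_neg_max _ j hj hj0 hmax
    have hden : μ i - μ j ≠ 0 := by linarith
    rw [sub_eq_iff_eq_add.1 h1, sub_eq_iff_eq_add.1 h2]
    field_simp
    ring
  | ogpSingle i _ hi hi0 hneg =>
    rw [sum_pick_mul]
    simp only [nextLoss, hi, if_true]
    have h1 := hL.sub_of_pos _ i hi hi0
    rw [hL.eq_zero _ hneg, zero_mul] at h1
    linarith
  | trial g _ _ _ hg => exact absurd hg.terminal hs
  | exploit g _ _ hg => exact absurd hg.terminal hs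
  | giveUp g hg => exact absurd hg.terminal hs

end Executions

/-! ### The asymptotic welfare of IREGB -/

section Limit

variable {Ω : Type*} [MeasurableSpace Ω] {P : Measure Ω} {K : ℕ} {X : Fin K → Ω → ℝ}
  {M : Strategy K}

/-- At the moment when the unexplored arms become terminal, the average future reward converges to
the best reward if a positive reward has been found, and to zero otherwise. -/
theorem tendsto_totalReward_div {μ : Fin K → ℝ} (hmech : IsMechanism M) (hM : IsIREGB μ M)
    {as : List (Option (Fin K))} {x : Fin K → ℝ} (hp : Possible M (hist as x))
    (hg : IsExplorationPart μ (hist as x) (hist as x)) :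
    Tendsto (fun n : ℕ => totalReward M x n (hist as x) / n) atTop
      (𝓝 (bestReward Finset.univ x - failed as x * bestReward Finset.univ x)) := by
  by_cases h : ∀ a ∈ as, reward x a ≤ 0
  · rw [failed_eq_one h, one_mul, sub_self]
    have : ∀ n, totalReward M x n (hist as x) = 0 := fun n =>
      totalReward_eq_zero hM x (fun e he => by
        obtain ⟨a, ha, rfl⟩ := List.mem_map.1 he
        exact h a ha) n hp hg
    simp only [this, zero_div]
    exact tendsto_const_nhds
  · rw [failed_eq_zero h, zero_mul, sub_zero]
    push Not at h
    obtain ⟨a, ha, ha0⟩ := h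
    have hlow := fun n => regret_le hM x (g := hist as x)
      ⟨(a, reward x a), List.mem_map.2 ⟨a, ha, rfl⟩, ha0⟩ n hp hg
    have h1 : Tendsto (fun n : ℕ => bestReward Finset.univ x -
        (unseen as).card * trialCost μ x / n) atTop (𝓝 (bestReward Finset.univ x - 0)) :=
      tendsto_const_nhds.sub (tendsto_const_div_atTop_nhds_zero_nat _)
    rw [sub_zero] at h1
    refine tendsto_of_tendsto_of_tendsto_of_le_of_le' h1 tendsto_const_nhds ?_ ?_
    · filter_upwards [eventually_gt_atTop 0] with n hn
      have hn' : (0 : ℝ) < n := by exact_mod_cast hn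
      rw [le_div_iff₀ hn', sub_mul, div_mul_cancel₀ _ hn'.ne']
      linarith [hlow n]
    · filter_upwards [eventually_gt_atTop 0] with n hn
      have hn' : (0 : ℝ) < n := by exact_mod_cast hn
      rw [div_le_iff₀ hn']
      linarith [totalReward_le hmech x n (hist as x)]

/-- While OGP is followed the potential is a martingale. Hence the average reward of IREGB converges
to the initial potential. -/
theorem tendsto_integral_weight_totalReward [IsProbabilityMeasure P] (hX : ∀ i, Measurable (X i))
    (hint : ∀ i, Integrable (X i) P) (hindep : iIndepFun X P)
    {L κ : Finset (Fin K) → ℝ} (hL : IsLoss (mean P X) (fun i => P.real {ω | X i ω ≤ 0})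
      (fun s => ∫ ω, bestReward s (fun i => X i ω) ∂P) L κ)
    (hmech : IsMechanism M) (hM : IsIREGB (mean P X) M) (m : ℕ) {as : List (Option (Fin K))}
    {w : Ω → ℝ} (hw : IsWeight M X as w) (hcard : (unseen as).card = m)
    (has : ∀ bs, bs <+: as → bs ≠ as → ¬ Terminal (mean P X) (unseen bs)) :
    Tendsto (fun n : ℕ =>
      (∫ ω, w ω * totalReward M (fun i => X i ω) n (hist as fun i => X i ω) ∂P) / n) atTop
      (𝓝 (∫ ω, w ω * potential L as (fun i => X i ω) ∂P)) := by
  induction m using Nat.strong_induction_on generalizing as w with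
  | _ m ih =>
    by_cases hT : Terminal (mean P X) (unseen as)
    · have hB := integrable_bestReward hX hint (P := P) Finset.univ
      have hF := integrable_failed hX (P := P) as
      have hfB : Integrable (fun ω => failed as (fun i => X i ω) *
          bestReward Finset.univ (fun i => X i ω)) P := by
        refine hB.bdd_mul (c := 1) hF.1 (Eventually.of_forall fun ω => ?_)
        rw [Real.norm_of_nonneg (failed_nonneg _ _)]
        exact failed_le_one _ _
      have hlim : ∫ ω, w ω * potential L as (fun i => X i ω) ∂P =
          ∫ ω, w ω * (bestReward Finset.univ (fun i => X i ω) -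
            failed as (fun i => X i ω) * bestReward Finset.univ (fun i => X i ω)) ∂P := by
        simp only [potential, mul_sub]
        rw [integral_sub (hw.integrable_mul hX hB) (hw.integrable_mul hX hfB),
          integral_sub (hw.integrable_mul hX hB) (hw.integrable_mul hX (hF.mul_const _)),
          integral_mul_failed_bestReward hX hindep hw.measurable,
          hL.eq_of_forall_neg _ (terminal_iff.1 hT)]
      rw [hlim]
      simp only [← integral_div]
      refine tendsto_integral_of_dominated_convergence (fun ω => ∑ i, |X i ω|) ?_
        (integrable_sum_abs hint) ?_ ?_
      · exact fun n => (((hw.measurable' hX).mul (measurable_totalReward hX hmech n as)).div_const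
          _).aestronglyMeasurable
      · refine fun n => Eventually.of_forall fun ω => ?_
        have hS : 0 ≤ ∑ i, |X i ω| := Finset.sum_nonneg fun i _ => abs_nonneg _
        rw [Real.norm_eq_abs, abs_div, abs_mul, abs_of_nonneg (hw.nonneg ω), Nat.abs_cast]
        refine div_le_of_le_mul₀ (Nat.cast_nonneg n) hS ?_
        calc _ ≤ 1 * (n * ∑ i, |X i ω|) :=
              mul_le_mul (hw.le_one ω) (abs_totalReward_le hmech _ _ _) (abs_nonneg _) zero_le_one
          _ = _ := by ring
      · refine Eventually.of_forall fun ω => ?_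
        by_cases hw0 : w ω = 0
        · simp only [hw0, zero_mul, zero_div]
          exact tendsto_const_nhds
        · simp only [mul_div_assoc]
          refine (tendsto_totalReward_div hmech hM (hw.possible ω hw0)
            ⟨List.prefix_rfl, ?_, ?_⟩).const_mul _
          · rwa [unexplored_hist]
          · intro g hg hne
            obtain ⟨bs, hbs, rfl⟩ : ∃ bs, bs <+: as ∧ g = hist bs fun i => X i ω := by
              rw [List.prefix_iff_eq_take] at hg
              refine ⟨as.take g.length, List.take_prefix _ _, ?_⟩
              rw [hist, List.map_take]
              exact hg
            rw [unexplored_hist]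
            exact has bs hbs fun h => hne (h ▸ rfl)
    · rw [← tendsto_add_atTop_iff_nat 1]
      simp only [integral_weight_totalReward_succ hX hint hmech hw]
      have hval : ∑ a, ∫ ω, w ω * M (hist as fun i => X i ω) a *
          potential L (as ++ [a]) (fun i => X i ω) ∂P =
          ∫ ω, w ω * potential L as (fun i => X i ω) ∂P := by
        rw [sum_integral_potential_append hX hint hindep hmech L hw]
        congr 1; funext ω
        by_cases hw0 : w ω = 0
        · simp [hw0]
        have hmv := hM _ (hw.possible ω hw0)
        have h2 := hmv.sum_nextLoss hL (by rwa [unexplored_hist])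
        rw [unexplored_hist] at h2
        rw [h2, potential]
      rw [← hval]
      simp only [Finset.sum_div]
      refine tendsto_finsetSum _ fun a _ => ?_
      have hlim : Tendsto (fun n : ℕ => (∫ ω, w ω * M (hist as fun i => X i ω) a *
          totalReward M (fun i => X i ω) n (hist (as ++ [a]) fun i => X i ω) ∂P) / n) atTop
          (𝓝 (∫ ω, w ω * M (hist as fun i => X i ω) a *
            potential L (as ++ [a]) (fun i => X i ω) ∂P)) := by
        by_cases ha : ∃ i ∈ unseen as, a = some i
        · obtain ⟨i, hi, rfl⟩ := ha
          refine ih _ ?_ (hw.append hmech (some i)) rfl ?_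
          · rw [unseen_append_some, ← hcard]
            exact Finset.card_erase_lt_of_mem hi
          · intro bs hbs hne
            rcases List.prefix_concat_iff.1 hbs with h | h
            · exact absurd h hne
            · by_cases hb : bs = as
              · rwa [hb]
              · exact has bs h hb
        · have hz : ∀ ω, w ω * M (hist as fun i => X i ω) a = 0 := by
            intro ω
            by_contra hne
            have hmv := hM _ (hw.possible ω (left_ne_zero_of_mul hne))
            have := hmv.mem_unexplored (by rwa [unexplored_hist]) (right_ne_zero_of_mul hne)
            rw [unexplored_hist] at this
            exact ha this
          simp only [hz, zero_mul, integral_zero, zero_div]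
          exact tendsto_const_nhds
      have h1 := (tendsto_const_div_atTop_nhds_zero_nat
        (∫ ω, w ω * M (hist as fun i => X i ω) a * reward (fun i => X i ω) a ∂P)).comp
          (tendsto_add_atTop_nat 1)
      have h2 := h1.add (hlim.mul (tendsto_natCast_div_add_atTop (1 : ℝ)))
      rw [zero_add, mul_one] at h2
      refine h2.congr' ?_
      filter_upwards [eventually_gt_atTop 0] with n hn
      have hn' : (n : ℝ) ≠ 0 := by exact_mod_cast hn.ne'
      simp only [Function.comp]
      push_cast
      rw [div_mul_div_comm, mul_comm (n : ℝ), mul_div_mul_right _ _ hn', ← add_div]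

end Limit

/-! ### The number of operations of the implementation -/

section Cost

variable {K : ℕ}

@[simp] theorem Timed.val_bind {α β : Type} (x : Timed α) (f : α → Timed β) :
    (x >>= f).val = (f x.val).val := rfl

@[simp] theorem Timed.cost_bind {α β : Type} (x : Timed α) (f : α → Timed β) :
    (x >>= f).cost = x.cost + (f x.val).cost := rfl

@[simp] theorem Timed.val_pure {α : Type} (a : α) : (pure a : Timed α).val = a := rfl

@[simp] theorem Timed.cost_pure {α : Type} (a : α) : (pure a : Timed α).cost = 0 := rfl

@[simp] theorem cost_tick (n : ℕ) : (tick n).cost = n := rfl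

theorem cost_better (b : Option (Fin K × ℝ)) (i : Fin K) (r : ℝ) : (better b i r).cost = 2 := by
  unfold better
  rcases b with _ | ⟨k, x⟩
  · simp
  · by_cases h : x < r <;> simp [h]

theorem cost_chooseAnchor (l : List (Fin K)) (b : Option (Fin K × ℝ)) :
    (chooseAnchor l b).cost = 3 := by
  unfold chooseAnchor
  rcases l with _ | ⟨i, l⟩ <;> rcases b with _ | ⟨k, x⟩
  · simp
  · by_cases h : 0 < x <;> simp [h]
  · simp
  · simp

theorem cost_update_le (m : Memory K) (e : Option (Fin K) × ℝ) : (update m e).cost ≤ 10 := by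
  rcases m with ⟨_ | ⟨i, l⟩, _ | ⟨j, l'⟩, b, _ | c⟩ <;> unfold update <;> dsimp only
  all_goals simp only [Timed.cost_bind, cost_tick, Timed.cost_pure]
  all_goals try split_ifs
  all_goals simp [cost_better, cost_chooseAnchor]

theorem cost_play_le (μ : Fin K → ℝ) (m : Memory K) : (play μ m).cost ≤ 8 := by
  rcases m with ⟨_ | ⟨i, l⟩, _ | ⟨j, l'⟩, b, _ | ⟨k, x⟩⟩ <;> unfold play <;>
    simp [mixLottery, pickLottery]

theorem roundCost_le (μ : Fin K → ℝ) (m : Memory K) (e : Option (Fin K) × ℝ) :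
    roundCost μ m e ≤ 18 :=
  Nat.add_le_add (cost_update_le m e) (cost_play_le μ _)

/-- Every change of the memory removes an unexplored arm from its lists. -/
theorem length_update_lt (m : Memory K) (e : Option (Fin K) × ℝ) (h : (update m e).val ≠ m) :
    (update m e).val.pos.length + (update m e).val.neg.length < m.pos.length + m.neg.length := by
  rcases m with ⟨_ | ⟨i, l⟩, _ | ⟨j, l'⟩, b, _ | c⟩ <;> revert h <;> unfold update <;> dsimp only
  all_goals simp only [Timed.val_bind, Timed.val_pure]
  all_goals try split_ifs
  all_goals simp

theorem changeCost_le (μ : Fin K → ℝ) (m : Memory K) (h : History K) :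
    changeCost μ m h ≤ 18 * (m.pos.length + m.neg.length) := by
  induction h generalizing m with
  | nil => simp [changeCost]
  | cons e h ih =>
    rw [changeCost]
    split_ifs with hm
    · have := ih (update m e).val
      rw [hm] at this ⊢
      omega
    · have h1 := ih (update m e).val
      have h2 := length_update_lt m e hm
      have h3 := roundCost_le μ m e
      omega

theorem classify_cost (μ : Fin K → ℝ) (l : List (Fin K)) :
    (classify μ l).cost = 3 * l.length + 1 := by
  induction l with
  | nil => simp [classify]
  | cons i l ih =>
    unfold classify
    by_cases h : 0 < μ i <;> simp [h, ih] <;> ring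

theorem classify_val (μ : Fin K → ℝ) (l : List (Fin K)) :
    (classify μ l).val =
      (l.filter fun i => decide (0 < μ i), l.filter fun i => decide ¬ 0 < μ i) := by
  induction l with
  | nil => simp [classify]
  | cons i l ih =>
    unfold classify
    by_cases h : 0 < μ i
    · simp [h, ih, not_le.2 h]
    · simp [h, ih, not_lt.1 h]

theorem merge_perm (μ : Fin K → ℝ) (l l' : List (Fin K)) : (merge μ l l').val.Perm (l ++ l') := by
  fun_induction merge μ l l' with
  | case1 l => exact List.Perm.refl _
  | case2 i l => simp
  | case3 i l j l' ih ih' =>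
    by_cases h : μ j ≤ μ i
    · simpa [h] using ih
    · simpa [h] using (ih'.cons j).trans List.perm_middle.symm

theorem merge_sorted (μ : Fin K → ℝ) (l l' : List (Fin K))
    (hl : l.Pairwise fun i j => μ j ≤ μ i) (hl' : l'.Pairwise fun i j => μ j ≤ μ i) :
    (merge μ l l').val.Pairwise fun i j => μ j ≤ μ i := by
  fun_induction merge μ l l' with
  | case1 l => exact hl'
  | case2 i l => exact hl
  | case3 i l j l' ih ih' =>
    have hi := List.pairwise_cons.1 hl
    have hj := List.pairwise_cons.1 hl'
    by_cases h : μ j ≤ μ i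
    · simp only [Timed.val_bind, h, if_true, Timed.val_pure]
      refine List.pairwise_cons.2 ⟨fun k hk => ?_, ih hi.2 hl'⟩
      have hk' := (merge_perm μ l (j :: l')).mem_iff.1 hk
      simp only [List.mem_append, List.mem_cons] at hk'
      rcases hk' with hk' | rfl | hk'
      · exact hi.1 k hk'
      · exact h
      · exact (hj.1 k hk').trans h
    · simp only [Timed.val_bind, h, if_false, Timed.val_pure]
      refine List.pairwise_cons.2 ⟨fun k hk => ?_, ih' hl hj.2⟩
      have hk' := (merge_perm μ (i :: l) l').mem_iff.1 hk
      have hij := (not_le.1 h).le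
      simp only [List.mem_append, List.mem_cons] at hk'
      rcases hk' with (rfl | hk') | hk'
      · exact hij
      · exact (hi.1 k hk').trans hij
      · exact hj.1 k hk'

theorem merge_cost (μ : Fin K → ℝ) (l l' : List (Fin K)) :
    (merge μ l l').cost ≤ 4 * (l.length + l'.length) + 2 := by
  fun_induction merge μ l l' with
  | case1 l => simp
  | case2 i l => simp
  | case3 i l j l' ih ih' =>
    simp only [List.length_cons] at ih ih' ⊢
    by_cases h : μ j ≤ μ i <;> simp [h] <;> omega

theorem sortByMean_perm (μ : Fin K → ℝ) (l : List (Fin K)) : (sortByMean μ l).val.Perm l := by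
  fun_induction sortByMean μ l with
  | case1 => exact List.Perm.refl _
  | case2 i => exact List.Perm.refl _
  | case3 i j l ih1 ih2 =>
    refine (merge_perm μ _ _).trans ((ih1.append ih2).trans ?_)
    rw [List.take_append_drop]

theorem sortByMean_sorted (μ : Fin K → ℝ) (l : List (Fin K)) :
    (sortByMean μ l).val.Pairwise fun i j => μ j ≤ μ i := by
  fun_induction sortByMean μ l with
  | case1 => exact List.Pairwise.nil
  | case2 i => exact List.pairwise_singleton _ _
  | case3 i j l ih1 ih2 => exact merge_sorted μ _ _ ih1 ih2

theorem sortByMean_cost (μ : Fin K → ℝ) (l : List (Fin K)) (k : ℕ) (hk : l.length ≤ 2 ^ k)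
    (hl : l ≠ []) : (sortByMean μ l).cost + 2 ≤ 7 * l.length * k + 4 * l.length := by
  fun_induction sortByMean μ l generalizing k with
  | case1 => exact absurd rfl hl
  | case2 i => simp
  | case3 i j l ih1 ih2 =>
    cases k with
    | zero => simp at hk
    | succ k =>
      set L := i :: j :: l with hL
      have hL2 : 2 ≤ L.length := by simp [hL]
      rw [pow_succ] at hk
      have ht : (L.take (L.length / 2)).length = L.length / 2 := by
        rw [List.length_take]; omega
      have hd : (L.drop (L.length / 2)).length = L.length - L.length / 2 := List.length_drop
      have h1 := ih1 k (by rw [ht]; omega) (by rw [← List.length_pos_iff_ne_nil]; omega)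
      have h2 := ih2 k (by rw [hd]; omega) (by rw [← List.length_pos_iff_ne_nil]; omega)
      have h3 := merge_cost μ (sortByMean μ (L.take (L.length / 2))).val
        (sortByMean μ (L.drop (L.length / 2))).val
      rw [(sortByMean_perm μ _).length_eq, (sortByMean_perm μ _).length_eq, ht, hd] at h3
      rw [ht] at h1
      rw [hd] at h2
      have h4 : 7 * (L.length / 2) * k + 7 * (L.length - L.length / 2) * k = 7 * L.length * k := by
        rw [← add_mul, ← mul_add]; congr 2; omega
      have h5 : 7 * L.length * (k + 1) = 7 * L.length * k + 7 * L.length := by ring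
      simp only [Timed.cost_bind, cost_tick]
      omega

theorem prepare_val_pos (μ : Fin K → ℝ) :
    (prepare μ).val.pos = (List.finRange K).filter fun i => decide (0 < μ i) := by
  simp [prepare, classify_val]

theorem prepare_val_neg_perm (μ : Fin K → ℝ) :
    (prepare μ).val.neg.Perm ((List.finRange K).filter fun i => decide ¬ 0 < μ i) := by
  have : (prepare μ).val.neg = (sortByMean μ (classify μ (List.finRange K)).val.2).val := rfl
  rw [this, classify_val]
  exact sortByMean_perm μ _

theorem prepare_val_neg_sorted (μ : Fin K → ℝ) :
    (prepare μ).val.neg.Pairwise fun i j => μ j ≤ μ i :=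
  sortByMean_sorted μ (classify μ (List.finRange K)).val.2

theorem length_prepare (μ : Fin K → ℝ) :
    (prepare μ).val.pos.length + (prepare μ).val.neg.length = K := by
  rw [prepare_val_pos, (prepare_val_neg_perm μ).length_eq]
  have := List.length_eq_length_filter_add (l := List.finRange K) fun i => decide (0 < μ i)
  simp only [List.length_finRange, ← decide_not] at this
  exact this.symm

theorem prepare_cost (μ : Fin K → ℝ) (k : ℕ) (hk : K ≤ 2 ^ k) :
    (prepare μ).cost ≤ 7 * K * k + 7 * K + 2 := by
  have h1 : (prepare μ).cost = (classify μ (List.finRange K)).cost +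
      (sortByMean μ (classify μ (List.finRange K)).val.2).cost := by
    simp [prepare]
  have h2 : (classify μ (List.finRange K)).val.2.length ≤ K := by
    rw [classify_val]
    exact (List.length_filter_le _ _).trans (List.length_finRange).le
  rw [h1, classify_cost, List.length_finRange]
  generalize (classify μ (List.finRange K)).val.2 = l at *
  by_cases hl : l = []
  · subst hl
    simp only [sortByMean, Timed.cost_bind, cost_tick, Timed.cost_pure]
    nlinarith [Nat.zero_le (7 * K * k)]
  · have h3 := sortByMean_cost μ l k (h2.trans hk) hl
    have h4 : 7 * l.length * k ≤ 7 * K * k := by gcongr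
    omega

/-- The total number of operations is `O(K log K)`. -/
theorem planningCost_le (μ : Fin K → ℝ) (hK : 2 ≤ K) (h : History K) :
    (planningCost μ h : ℝ) ≤ 100 * (K * Real.log K) := by
  have hk : K ≤ 2 ^ (Nat.log 2 K + 1) := (Nat.lt_pow_succ_log_self one_lt_two K).le
  have h1 := prepare_cost μ _ hk
  have h2 := cost_play_le μ (prepare μ).val
  have h3 := changeCost_le μ (prepare μ).val h
  rw [length_prepare] at h3
  have h4 : planningCost μ h ≤ 7 * K * (Nat.log 2 K + 1) + 25 * K + 10 := by
    unfold planningCost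
    omega
  have h5 : (planningCost μ h : ℝ) ≤ 7 * K * (Nat.log 2 K + 1) + 25 * K + 10 := by
    exact_mod_cast h4
  have hK' : (2 : ℝ) ≤ K := by exact_mod_cast hK
  have hlog2 : (1 / 2 : ℝ) ≤ Real.log 2 := by linarith [Real.log_two_gt_d9]
  have hlog : Real.log 2 ≤ Real.log K := Real.log_le_log (by norm_num) hK'
  have h6 : (Nat.log 2 K : ℝ) * Real.log 2 ≤ Real.log K := by
    rw [← Real.log_pow]
    refine Real.log_le_log (by positivity) ?_
    exact_mod_cast Nat.pow_log_le_self 2 (by omega)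
  have h7 : (Nat.log 2 K : ℝ) ≤ 2 * Real.log K := by
    nlinarith [(Nat.log 2 K).cast_nonneg (α := ℝ)]
  have h8 : (K : ℝ) ≤ 2 * (K * Real.log K) := by nlinarith
  have h9 : (K : ℝ) * Nat.log 2 K ≤ 2 * (K * Real.log K) := by nlinarith
  nlinarith

end Cost

/-! ### The implementation computes a mechanism -/

section Mechanism

variable {K : ℕ} {μ : Fin K → ℝ}

theorem Lottery.sum_weights (l : Lottery K) : ∑ c, l.weights c = l.pFst + l.pSnd := by
  simp [Lottery.weights, Finset.sum_add_distrib]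

theorem Lottery.weights_nonneg {l : Lottery K} (h1 : 0 ≤ l.pFst) (h2 : 0 ≤ l.pSnd)
    (c : Option (Fin K)) : 0 ≤ l.weights c := by
  unfold Lottery.weights
  split_ifs <;> simp [h1, h2, add_nonneg]

/-- The conditions on the memory under which the computed weights are probabilities; they hold
after arbitrary histories. -/
structure IsSound (μ : Fin K → ℝ) (m : Memory K) : Prop where
  pos : ∀ i ∈ m.pos, 0 < μ i
  neg : ∀ j ∈ m.neg, μ j < 0
  anchor : ∀ k x, m.anchor = some (k, x) → 0 < x

theorem chooseAnchor_pos {l : List (Fin K)} {b : Option (Fin K × ℝ)} {k : Fin K} {x : ℝ}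
    (h : (chooseAnchor l b).val = some (k, x)) : 0 < x := by
  unfold chooseAnchor at h
  rcases l with _ | ⟨i, l⟩ <;> rcases b with _ | ⟨k', x'⟩ <;> dsimp only at h
  · simp at h
  · by_cases hx : 0 < x'
    · simp only [Timed.val_bind, hx, if_true, Timed.val_pure, Option.some.injEq,
        Prod.mk.injEq] at h
      exact h.2 ▸ hx
    · simp [hx] at h
  · simp at h
  · simp at h

theorem isSound_prepare (hμ : ∀ i, μ i ≠ 0) : IsSound μ (prepare μ).val where
  pos i hi := by
    rw [prepare_val_pos] at hi
    simpa using (List.mem_filter.1 hi).2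
  neg j hj := by
    have := (List.mem_filter.1 ((prepare_val_neg_perm μ).mem_iff.1 hj)).2
    exact lt_of_le_of_ne (by simpa using this) (hμ j)
  anchor k x h := by simp [prepare] at h

theorem IsSound.update {m : Memory K} (hm : IsSound μ m) (e : Option (Fin K) × ℝ) :
    IsSound μ (update m e).val := by
  obtain ⟨h1, h2, h3⟩ := hm
  rcases m with ⟨_ | ⟨i, l⟩, _ | ⟨j, l'⟩, b, _ | c⟩ <;> unfold IRSR.update <;> dsimp only at *
  all_goals simp only [Timed.val_bind, Timed.val_pure]
  all_goals try split_ifs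
  all_goals first
    | exact ⟨h1, h2, h3⟩
    | exact ⟨h1, fun k hk => h2 k (List.mem_cons_of_mem _ hk), h3⟩
    | exact ⟨fun k hk => h1 k (List.mem_cons_of_mem _ hk), h2, fun k x h => chooseAnchor_pos h⟩

theorem isSound_memoryAfter (hμ : ∀ i, μ i ≠ 0) (h : History K) :
    IsSound μ (memoryAfter μ h) := by
  induction h using List.reverseRecOn with
  | nil => exact isSound_prepare hμ
  | append_singleton h e ih =>
    rw [memoryAfter, List.foldl_append]
    exact ih.update e

theorem mixLottery_isProb (i : Fin K) {v : ℝ} (j : Fin K) {w : ℝ} (hv : 0 < v) (hw : w < 0) :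
    0 ≤ (mixLottery i v j w).val.pFst ∧ 0 ≤ (mixLottery i v j w).val.pSnd ∧
      (mixLottery i v j w).val.pFst + (mixLottery i v j w).val.pSnd = 1 := by
  have h : 0 < v - w := by linarith
  refine ⟨div_nonneg (by linarith) h.le, div_nonneg hv.le h.le, ?_⟩
  change -w / (v - w) + v / (v - w) = 1
  field_simp
  ring

theorem pickLottery_isProb (a : Option (Fin K)) :
    0 ≤ (pickLottery a).val.pFst ∧ 0 ≤ (pickLottery a).val.pSnd ∧
      (pickLottery a).val.pFst + (pickLottery a).val.pSnd = 1 :=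
  ⟨zero_le_one, le_rfl, add_zero 1⟩

theorem IsSound.play {m : Memory K} (hm : IsSound μ m) :
    0 ≤ (play μ m).val.pFst ∧ 0 ≤ (play μ m).val.pSnd ∧
      (play μ m).val.pFst + (play μ m).val.pSnd = 1 := by
  obtain ⟨h1, h2, h3⟩ := hm
  rcases m with ⟨_ | ⟨i, l⟩, _ | ⟨j, l'⟩, b, _ | ⟨k, x⟩⟩ <;> unfold IRSR.play <;>
    dsimp only at * <;> simp only [Timed.val_bind]
  all_goals first
    | exact pickLottery_isProb _
    | exact mixLottery_isProb _ _ (h1 _ List.mem_cons_self) (h2 _ List.mem_cons_self)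
    | exact mixLottery_isProb _ _ (h3 _ _ rfl) (h2 _ List.mem_cons_self)

/-! ### Measurability of the implementation -/

/-- The discrete part of a memory: the two lists, the best arm and the anchor. It takes countably
many values, so measurability can be checked for each of them separately. -/
structure Shape (K : ℕ) where
  pos : List (Fin K)
  neg : List (Fin K)
  best : Option (Fin K)
  anchor : Option (Fin K)

instance : MeasurableSpace (Shape K) := ⊤

instance : DiscreteMeasurableSpace (Shape K) := ⟨fun _ => trivial⟩

instance : Countable (Shape K) :=
  Function.Injective.countable
    (f := fun s : Shape K => (s.pos, s.neg, s.best, s.anchor)) fun s t h => by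
      cases s; cases t; simpa using h

/-- The memory with a given discrete part and given rewards of the best arm and the anchor. -/
def Shape.toMemory (s : Shape K) (y z : ℝ) : Memory K :=
  ⟨s.pos, s.neg, s.best.map fun k => (k, y), s.anchor.map fun k => (k, z)⟩

/-- The discrete part and the rewards of a memory; an absent reward is recorded as zero. -/
def Memory.encode (m : Memory K) : Shape K × ℝ × ℝ :=
  (⟨m.pos, m.neg, m.best.map Prod.fst, m.anchor.map Prod.fst⟩,
    (m.best.map Prod.snd).getD 0, (m.anchor.map Prod.snd).getD 0)

theorem toMemory_encode (m : Memory K) :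
    m.encode.1.toMemory m.encode.2.1 m.encode.2.2 = m := by
  rcases m with ⟨p, n, _ | ⟨k, y⟩, _ | ⟨k', z⟩⟩ <;> rfl

theorem measurable_of_cases {α β : Type*} [MeasurableSpace α] [MeasurableSpace β]
    {c : α → Prop} {h f g : α → β} (hc : MeasurableSet {a | c a}) (hf : Measurable f)
    (hg : Measurable g) (h1 : ∀ a, c a → h a = f a) (h2 : ∀ a, ¬ c a → h a = g a) :
    Measurable h := by
  classical
  have : h = fun a => if c a then f a else g a := by
    funext a
    split_ifs with ha
    · exact h1 a ha
    · exact h2 a ha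
  rw [this]
  exact Measurable.ite hc hf hg

theorem measurable_encode_mk {α : Type*} [MeasurableSpace α] (p n : List (Fin K))
    (b c : Option (Fin K)) {y z : α → ℝ} (hy : Measurable y) (hz : Measurable z) :
    Measurable fun a =>
      (Memory.mk p n (b.map fun k => (k, y a)) (c.map fun k => (k, z a))).encode := by
  cases b <;> cases c <;> simp only [Memory.encode, Option.map_none, Option.map_some,
    Option.getD_none, Option.getD_some] <;> fun_prop

theorem measurable_encode_chooseAnchor {α : Type*} [MeasurableSpace α] (p n : List (Fin K))
    (k : Fin K) {y : α → ℝ} (hy : Measurable y) :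
    Measurable fun a =>
      (Memory.mk p n (some (k, y a)) (chooseAnchor p (some (k, y a))).val).encode := by
  unfold chooseAnchor
  cases p with
  | nil =>
    refine measurable_of_cases (c := fun a => 0 < y a) (measurableSet_lt measurable_const hy)
      (measurable_encode_mk [] n (some k) (some k) hy hy)
      (measurable_encode_mk [] n (some k) none hy hy) (fun a ha => ?_) fun a ha => ?_ <;>
    simp [ha]
  | cons i l => exact measurable_encode_mk (i :: l) n (some k) none hy hy

theorem measurable_encode_better {α : Type*} [MeasurableSpace α] (p n : List (Fin K))
    (b c : Option (Fin K)) (i : Fin K) {y z r : α → ℝ} (hy : Measurable y) (hz : Measurable z)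
    (hr : Measurable r) :
    Measurable fun a => (Memory.mk p n (better (b.map fun k => (k, y a)) i (r a)).val
      (c.map fun k => (k, z a))).encode := by
  unfold better
  cases b with
  | none => exact measurable_encode_mk p n (some i) c hr hz
  | some k =>
    refine measurable_of_cases (c := fun a => y a < r a) (measurableSet_lt hy hr)
      (measurable_encode_mk p n (some i) c hr hz)
      (measurable_encode_mk p n (some k) c hy hz) (fun a ha => ?_) fun a ha => ?_ <;>
    simp [ha]

theorem measurable_encode_better_chooseAnchor {α : Type*} [MeasurableSpace α]
    (p n : List (Fin K)) (b : Option (Fin K)) (i : Fin K) {y r : α → ℝ} (hy : Measurable y)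
    (hr : Measurable r) :
    Measurable fun a => (Memory.mk p n (better (b.map fun k => (k, y a)) i (r a)).val
      (chooseAnchor p (better (b.map fun k => (k, y a)) i (r a)).val).val).encode := by
  unfold better
  cases b with
  | none => exact measurable_encode_chooseAnchor p n i hr
  | some k =>
    refine measurable_of_cases (c := fun a => y a < r a) (measurableSet_lt hy hr)
      (measurable_encode_chooseAnchor p n i hr)
      (measurable_encode_chooseAnchor p n k hy) (fun a ha => ?_) fun a ha => ?_ <;>
    simp [ha]

theorem measurable_encode_update (s : Shape K) (e : Option (Fin K)) :
    Measurable fun v : (ℝ × ℝ) × ℝ => (update (s.toMemory v.1.1 v.1.2) (e, v.2)).val.encode := by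
  have hy : Measurable fun v : (ℝ × ℝ) × ℝ => v.1.1 := by fun_prop
  have hz : Measurable fun v : (ℝ × ℝ) × ℝ => v.1.2 := by fun_prop
  have hr : Measurable fun v : (ℝ × ℝ) × ℝ => v.2 := by fun_prop
  rcases s with ⟨_ | ⟨i, l⟩, _ | ⟨j, l'⟩, b, _ | c⟩ <;>
    simp only [update, Shape.toMemory, Timed.val_bind, Option.map_none, Option.map_some]
  all_goals try split_ifs
  all_goals simp only [Timed.val_pure, Timed.val_bind]
  all_goals first
    | exact measurable_encode_mk _ _ b none hy hz
    | exact measurable_encode_mk _ _ b (some c) hy hz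
    | exact measurable_encode_better _ _ b none _ hy hz hr
    | exact measurable_encode_better _ _ b (some c) _ hy hz hr
    | exact measurable_encode_better_chooseAnchor _ _ b _ hy hr

theorem measurable_encode_memoryAfter (n : ℕ) (a : Fin n → Option (Fin K)) :
    Measurable fun x : Fin n → ℝ => (memoryAfter μ (List.ofFn fun t => (a t, x t))).encode := by
  induction n with
  | zero => simp only [List.ofFn_zero]; exact measurable_const
  | succ n ih =>
    have hstep : Measurable fun v : Shape K × ((ℝ × ℝ) × ℝ) =>
        (update (v.1.toMemory v.2.1.1 v.2.1.2) (a (Fin.last n), v.2.2)).val.encode :=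
      measurable_from_prod_countable_right fun s => measurable_encode_update s _
    have hprev := (ih fun t => a t.castSucc).comp
      (measurable_pi_lambda (fun (x : Fin (n + 1) → ℝ) (t : Fin n) => x t.castSucc)
        fun t => measurable_pi_apply t.castSucc)
    have hlast : Measurable fun x : Fin (n + 1) → ℝ => x (Fin.last n) := measurable_pi_apply _
    have := hstep.comp
      ((measurable_fst.comp hprev).prodMk ((measurable_snd.comp hprev).prodMk hlast))
    simp only [Function.comp_def, toMemory_encode] at this
    simpa only [List.ofFn_succ', List.concat_eq_append, memoryAfter, List.foldl_append,
      List.foldl_cons, List.foldl_nil] using this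

theorem measurable_play (s : Shape K) (c : Option (Fin K)) :
    Measurable fun v : ℝ × ℝ => (play μ (s.toMemory v.1 v.2)).val.weights c := by
  rcases s with ⟨_ | ⟨i, l⟩, _ | ⟨j, l'⟩, b, _ | k⟩ <;>
    simp only [play, Shape.toMemory, Timed.val_bind, Option.map_none, Option.map_some,
      mixLottery, pickLottery, Timed.val_pure, Lottery.weights, Option.map_map,
      Function.comp_def]
  all_goals
    refine Measurable.add (Measurable.ite (MeasurableSet.const _) ?_ measurable_const)
      (Measurable.ite (MeasurableSet.const _) ?_ measurable_const) <;>
    fun_prop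

theorem isMechanism_program (hμ : ∀ i, μ i ≠ 0) : IsMechanism (program μ) where
  nonneg h a := by
    have := (isSound_memoryAfter hμ h).play
    exact Lottery.weights_nonneg this.1 this.2.1 a
  sum_eq_one h := by
    rw [program, Lottery.sum_weights]
    exact (isSound_memoryAfter hμ h).play.2.2
  measurable n a b := by
    have hplay : Measurable fun v : Shape K × (ℝ × ℝ) =>
        (play μ (v.1.toMemory v.2.1 v.2.2)).val.weights b :=
      measurable_from_prod_countable_right fun s => measurable_play s b
    have := hplay.comp (measurable_encode_memoryAfter (μ := μ) n a)
    simpa only [Function.comp_def, toMemory_encode, program] using this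

end Mechanism

/-! ### The implementation follows IREGB -/

section Program

variable {K : ℕ} {μ : Fin K → ℝ}

/-- `b` is a best arm among `as`, with its reward. -/
def IsBest (as : List (Option (Fin K))) (x : Fin K → ℝ) (b : Option (Fin K × ℝ)) : Prop :=
  (∀ k y, b = some (k, y) → some k ∈ as ∧ y = x k) ∧
    ∀ i, some i ∈ as → ∃ k y, b = some (k, y) ∧ x i ≤ y

theorem IsBest.better {as : List (Option (Fin K))} {x : Fin K → ℝ} {b : Option (Fin K × ℝ)}
    (hb : IsBest as x b) (i : Fin K) :
    IsBest (as ++ [some i]) x (better b i (x i)).val := by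
  obtain ⟨h1, h2⟩ := hb
  unfold IRSR.better
  rcases b with _ | ⟨k, y⟩
  · refine ⟨fun k' y' h => ?_, fun i' hi' => ⟨i, x i, rfl, ?_⟩⟩
    · simp only [Timed.val_bind, Timed.val_pure, Option.some.injEq, Prod.mk.injEq] at h
      obtain ⟨rfl, rfl⟩ := h
      simp
    · rcases List.mem_append.1 hi' with h | h
      · obtain ⟨k, y, hk, -⟩ := h2 i' h
        exact absurd hk (by simp)
      · simp only [List.mem_singleton, Option.some.injEq] at h
        rw [h]
  · by_cases hlt : y < x i
    · refine ⟨fun k' y' h => ?_, fun i' hi' => ⟨i, x i, by simp [hlt], ?_⟩⟩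
      · simp only [Timed.val_bind, hlt, if_true, Timed.val_pure, Option.some.injEq,
          Prod.mk.injEq] at h
        obtain ⟨rfl, rfl⟩ := h
        simp
      · rcases List.mem_append.1 hi' with h | h
        · obtain ⟨k', y', hk, hle⟩ := h2 i' h
          simp only [Option.some.injEq, Prod.mk.injEq] at hk
          obtain ⟨rfl, rfl⟩ := hk
          exact hle.trans hlt.le
        · simp only [List.mem_singleton, Option.some.injEq] at h
          rw [h]
    · refine ⟨fun k' y' h => ?_, fun i' hi' => ⟨k, y, by simp [hlt], ?_⟩⟩
      · simp only [Timed.val_bind, hlt, if_false, Timed.val_pure] at h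
        have := h1 k' y' h
        exact ⟨List.mem_append_left _ this.1, this.2⟩
      · rcases List.mem_append.1 hi' with h | h
        · obtain ⟨k', y', hk, hle⟩ := h2 i' h
          simp only [Option.some.injEq, Prod.mk.injEq] at hk
          obtain ⟨rfl, rfl⟩ := hk
          exact hle
        · simp only [List.mem_singleton, Option.some.injEq] at h
          rw [h]
          exact not_lt.1 hlt

theorem IsBest.append {as : List (Option (Fin K))} {x : Fin K → ℝ} {b : Option (Fin K × ℝ)}
    (hb : IsBest as x b) {a : Option (Fin K)} (ha : ∀ i, a = some i → some i ∈ as) :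
    IsBest (as ++ [a]) x b := by
  refine ⟨fun k y h => ?_, fun i hi => ?_⟩
  · exact ⟨List.mem_append_left _ (hb.1 k y h).1, (hb.1 k y h).2⟩
  · rcases List.mem_append.1 hi with h | h
    · exact hb.2 i h
    · exact hb.2 i (ha i (List.mem_singleton.1 h).symm)

/-- What the anchor records once `g` is known to be the exploration part. -/
def IsAnchor (g : History K) (c : Option (Fin K × ℝ)) : Prop :=
  (∃ k y, c = some (k, y) ∧ (some k, y) ∈ g ∧ 0 < y ∧ ∀ e ∈ g, e.2 ≤ y) ∨
    (c = none ∧ ∀ e ∈ g, e.2 ≤ 0)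

theorem IsBest.isAnchor {as : List (Option (Fin K))} {x : Fin K → ℝ} {b : Option (Fin K × ℝ)}
    (hb : IsBest as x b) : IsAnchor (hist as x) (chooseAnchor [] b).val := by
  have hle : ∀ y, 0 ≤ y → (∀ i, some i ∈ as → x i ≤ y) → ∀ e ∈ hist as x, e.2 ≤ y := by
    intro y hy h e he
    obtain ⟨a, ha, rfl⟩ := List.mem_map.1 he
    cases a with
    | none => exact hy
    | some i => exact h i ha
  have hbest : ∀ k y, b = some (k, y) → ∀ i, some i ∈ as → x i ≤ y := by
    intro k y hk i hi
    obtain ⟨k', y', h, hxy⟩ := hb.2 i hi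
    rw [hk] at h
    simp only [Option.some.injEq, Prod.mk.injEq] at h
    exact h.2 ▸ hxy
  unfold chooseAnchor
  rcases b with _ | ⟨k, y⟩
  · refine Or.inr ⟨rfl, hle 0 le_rfl fun i hi => ?_⟩
    obtain ⟨k, y, h, -⟩ := hb.2 i hi
    exact absurd h (by simp)
  · by_cases hy : 0 < y
    · obtain ⟨hk, hxk⟩ := hb.1 k y rfl
      refine Or.inl ⟨k, y, by simp [hy], ?_, hy, hle y hy.le (hbest k y rfl)⟩
      rw [hxk]
      exact List.mem_map.2 ⟨some k, hk, rfl⟩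
    · refine Or.inr ⟨by simp [hy], hle 0 le_rfl fun i hi => ?_⟩
      exact (hbest k y rfl i hi).trans (not_lt.1 hy)

/-- The memory `m` is correct after the selection of the arms `as`. -/
structure Tracks (μ : Fin K → ℝ) (as : List (Option (Fin K))) (x : Fin K → ℝ) (m : Memory K) :
    Prop where
  mem_pos : ∀ i, i ∈ m.pos ↔ i ∈ unseen as ∧ 0 < μ i
  nodup_pos : m.pos.Nodup
  mem_neg : ∀ i, i ∈ m.neg ↔ i ∈ unseen as ∧ μ i < 0
  nodup_neg : m.neg.Nodup
  sorted_neg : m.neg.Pairwise fun i j => μ j ≤ μ i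
  best : IsBest as x m.best
  anchor_eq_none : m.pos ≠ [] → m.anchor = none
  anchor : m.pos = [] → ∃ g, IsExplorationPart μ (hist as x) g ∧ IsAnchor g m.anchor

theorem tracks_prepare (hμ : ∀ i, μ i ≠ 0) (x : Fin K → ℝ) : Tracks μ [] x (prepare μ).val where
  mem_pos i := by simp [prepare_val_pos, mem_unseen]
  nodup_pos := by
    rw [prepare_val_pos]
    exact (List.nodup_finRange K).filter _
  mem_neg i := by
    rw [(prepare_val_neg_perm μ).mem_iff]
    have := (hμ i).le_iff_lt
    simp [mem_unseen, this]
  nodup_neg := (prepare_val_neg_perm μ).nodup_iff.2 ((List.nodup_finRange K).filter _)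
  sorted_neg := prepare_val_neg_sorted μ
  best := ⟨fun k y h => by simp [prepare] at h, fun i hi => by simp at hi⟩
  anchor_eq_none _ := rfl
  anchor h := by
    refine ⟨[], ⟨List.nil_prefix, terminal_iff.2 fun i _ => ?_, fun g hg hne => ?_⟩,
      Or.inr ⟨rfl, by simp⟩⟩
    · rw [prepare_val_pos] at h
      have := List.filter_eq_nil_iff.1 h i (List.mem_finRange i)
      exact lt_of_le_of_ne (by simpa using this) (hμ i)
    · exact absurd (List.prefix_nil.1 hg) hne

theorem weights_pickLottery (a : Option (Fin K)) : (pickLottery a).val.weights = pick a := by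
  funext c
  by_cases h : c = a <;> simp [pickLottery, Lottery.weights, pick, h]

theorem weights_mixLottery {i j : Fin K} (hij : i ≠ j) (v w : ℝ) :
    (mixLottery i v j w).val.weights = mix i v j w := by
  funext c
  by_cases h : c = some i
  · simp [mixLottery, Lottery.weights, mix, h, hij]
  · by_cases h' : c = some j <;> simp [mixLottery, Lottery.weights, mix, h, h', hij.symm]

variable {as : List (Option (Fin K))} {x : Fin K → ℝ}

theorem Tracks.anchor_mem {m : Memory K} (hm : Tracks μ as x m) {k : Fin K} {y : ℝ}
    (h : m.anchor = some (k, y)) : some k ∈ as := by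
  have hpos : m.pos = [] := by
    by_contra hne
    rw [hm.anchor_eq_none hne] at h
    exact absurd h (by simp)
  obtain ⟨g, hg, hga⟩ := hm.anchor hpos
  rcases hga with ⟨k', y', h1, h2, -⟩ | ⟨h1, -⟩
  · rw [h1] at h
    simp only [Option.some.injEq, Prod.mk.injEq] at h
    exact h.1 ▸ (eq_of_mem_hist (hg.1.subset h2)).1
  · rw [h1] at h
    exact absurd h (by simp)

theorem Tracks.move (hμ : ∀ i, μ i ≠ 0) {m : Memory K} (hm : Tracks μ as x m) :
    IREGBMove μ (hist as x) (play μ m).val.weights := by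
  have hanchor := @Tracks.anchor_mem _ _ _ _ _ hm
  obtain ⟨hpos, hposn, hneg, hnegn, hsort, hbest, hnone, hanc⟩ := hm
  rcases m with ⟨_ | ⟨i, l⟩, n, b, c⟩ <;> dsimp only at *
  · obtain ⟨g, hg, hga⟩ := hanc rfl
    rcases hga with ⟨k, y, rfl, hk, hy, hmax⟩ | ⟨rfl, hle⟩
    · rcases n with _ | ⟨j, l'⟩
      · have hall : unseen as = ∅ := by
          refine Finset.eq_empty_of_forall_notMem fun i hi => ?_
          rcases lt_or_gt_of_ne (hμ i) with h | h
          · exact absurd ((hneg i).2 ⟨hi, h⟩) (by simp)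
          · exact absurd ((hpos i).2 ⟨hi, h⟩) (by simp)
        obtain ⟨hk1, hyk⟩ := eq_of_mem_hist (hg.1.subset hk)
        obtain ⟨k', y', rfl, hyy⟩ := hbest.2 k hk1
        obtain ⟨hk1', rfl⟩ := hbest.1 k' y' rfl
        have : (play μ ⟨[], [], some (k', x k'), some (k, y)⟩).val.weights = pick (some k') :=
          weights_pickLottery _
        rw [this]
        refine IREGBMove.exploit g k' (x k') hg ⟨_, hk, hy⟩ (by rwa [unexplored_hist])
          (List.mem_map.2 ⟨some k', hk1', rfl⟩) fun e he => ?_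
        obtain ⟨a, ha, rfl⟩ := List.mem_map.1 he
        cases a with
        | none => exact hy.le.trans (hyk ▸ hyy)
        | some i =>
          obtain ⟨k2, y2, h2, hle2⟩ := hbest.2 i ha
          simp only [Option.some.injEq, Prod.mk.injEq] at h2
          exact h2.2 ▸ hle2
      · have hj := (hneg j).1 List.mem_cons_self
        have hkj : k ≠ j := by
          rintro rfl
          exact mem_unseen.1 hj.1 (hanchor rfl)
        have : (play μ ⟨[], j :: l', b, some (k, y)⟩).val.weights = mix k y j (μ j) :=
          weights_mixLottery hkj _ _
        rw [this]
        exact IREGBMove.trial g k j y hg hk hy hmax (by rw [unexplored_hist]; exact hj.1)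
    · have : (play μ ⟨[], n, b, none⟩).val.weights = pick none := weights_pickLottery _
      rw [this]
      exact IREGBMove.giveUp g hg hle
  · have hi := (hpos i).1 List.mem_cons_self
    have hs : ¬ Terminal μ (unexplored (hist as x)) := by
      rw [terminal_iff, unexplored_hist]
      exact fun h => (h i hi.1).not_gt hi.2
    rcases n with _ | ⟨j, l'⟩
    · have : (play μ ⟨i :: l, [], b, c⟩).val.weights = pick (some i) := weights_pickLottery _
      rw [this]
      refine IREGBMove.ogpSingle i hs (by rw [unexplored_hist]; exact hi.1) hi.2 fun j hj hj0 => ?_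
      rw [unexplored_hist] at hj
      exact absurd ((hneg j).2 ⟨hj, hj0⟩) (by simp)
    · have hj := (hneg j).1 List.mem_cons_self
      have hij : i ≠ j := by
        rintro rfl
        exact hi.2.not_gt hj.2
      have : (play μ ⟨i :: l, j :: l', b, c⟩).val.weights = mix i (μ i) j (μ j) :=
        weights_mixLottery hij _ _
      rw [this]
      refine IREGBMove.ogpMix i j hs (by rw [unexplored_hist]; exact hi.1) hi.2
        (by rw [unexplored_hist]; exact hj.1) hj.2 fun j' hj' hj0' => ?_
      rw [unexplored_hist] at hj'
      rcases List.mem_cons.1 ((hneg j').2 ⟨hj', hj0'⟩) with rfl | h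
      · exact le_rfl
      · exact (List.pairwise_cons.1 hsort).1 j' h

/-- Selecting an arm again does not change the memory. -/
theorem Tracks.append_seen {m : Memory K} (hm : Tracks μ as x m) {a : Option (Fin K)}
    (ha : ∀ i, a = some i → some i ∈ as) : Tracks μ (as ++ [a]) x m := by
  have hun : unseen (as ++ [a]) = unseen as := by
    cases a with
    | none => exact unseen_append_none as
    | some i => exact unseen_append_of_seen fun h => mem_unseen.1 h (ha i rfl)
  refine ⟨hun ▸ hm.mem_pos, hm.nodup_pos, hun ▸ hm.mem_neg, hm.nodup_neg, hm.sorted_neg,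
    hm.best.append ha, hm.anchor_eq_none, fun h => ?_⟩
  obtain ⟨g, hg, hga⟩ := hm.anchor h
  exact ⟨g, hg.of_prefix (hist_append as a x ▸ List.prefix_append _ _), hga⟩

theorem mem_tail_iff {i : Fin K} {l : List (Fin K)} (hn : (i :: l).Nodup) {p : Fin K → Prop}
    (h : ∀ k, k ∈ i :: l ↔ k ∈ unseen as ∧ p k) (k : Fin K) :
    k ∈ l ↔ k ∈ unseen (as ++ [some i]) ∧ p k := by
  rw [unseen_append_some, Finset.mem_erase, and_assoc, ← h k, List.mem_cons]
  have := (List.nodup_cons.1 hn).1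
  constructor
  · intro hk
    exact ⟨fun hki => this (hki ▸ hk), Or.inr hk⟩
  · rintro ⟨h1, h2⟩
    exact h2.resolve_left h1

theorem mem_iff_append {i : Fin K} {l : List (Fin K)} {p : Fin K → Prop} (hi : ¬ p i)
    (h : ∀ k, k ∈ l ↔ k ∈ unseen as ∧ p k) (k : Fin K) :
    k ∈ l ↔ k ∈ unseen (as ++ [some i]) ∧ p k := by
  rw [unseen_append_some, Finset.mem_erase, h k]
  constructor
  · rintro ⟨h1, h2⟩
    exact ⟨⟨fun hk => hi (hk ▸ h2), h1⟩, h2⟩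
  · rintro ⟨⟨-, h1⟩, h2⟩
    exact ⟨h1, h2⟩

/-- The first arm of positive mean is explored. -/
theorem Tracks.explore_pos (hμ : ∀ i, μ i ≠ 0) {i : Fin K} {l n : List (Fin K)}
    {b c : Option (Fin K × ℝ)} (hm : Tracks μ as x ⟨i :: l, n, b, c⟩) :
    Tracks μ (as ++ [some i]) x
      ⟨l, n, (better b i (x i)).val, (chooseAnchor l (better b i (x i)).val).val⟩ := by
  have hi := (hm.mem_pos i).1 List.mem_cons_self
  have hpos := mem_tail_iff hm.nodup_pos hm.mem_pos
  have hbest := hm.best.better i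
  refine ⟨hpos, (List.nodup_cons.1 hm.nodup_pos).2, mem_iff_append hi.2.not_gt hm.mem_neg,
    hm.nodup_neg, hm.sorted_neg, hbest, fun hne => ?_, fun hnil => ?_⟩
  · obtain ⟨i', l', rfl⟩ := List.exists_cons_of_ne_nil (show l ≠ [] from hne)
    rfl
  · obtain rfl : l = [] := hnil
    refine ⟨hist (as ++ [some i]) x, ⟨List.prefix_rfl, ?_, fun g hg hne hT => ?_⟩,
      hbest.isAnchor⟩
    · rw [terminal_iff, unexplored_hist]
      intro k hk
      refine lt_of_le_of_ne (not_lt.1 fun hk0 => ?_) (hμ k)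
      exact absurd ((hpos k).2 ⟨hk, hk0⟩) (by simp)
    · rw [hist_append] at hg hne
      have hg' := (List.prefix_concat_iff.1 hg).resolve_left hne
      have hmem := unexplored_anti hg' (by rw [unexplored_hist]; exact hi.1)
      exact (terminal_iff.1 hT i hmem).not_gt hi.2

/-- The first arm of negative mean is explored. -/
theorem Tracks.explore_neg {j : Fin K} {p l : List (Fin K)} {b c : Option (Fin K × ℝ)}
    (hm : Tracks μ as x ⟨p, j :: l, b, c⟩) :
    Tracks μ (as ++ [some j]) x ⟨p, l, (better b j (x j)).val, c⟩ := by
  have hj := (hm.mem_neg j).1 List.mem_cons_self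
  refine ⟨mem_iff_append hj.2.not_gt hm.mem_pos, hm.nodup_pos,
    mem_tail_iff hm.nodup_neg hm.mem_neg, (List.nodup_cons.1 hm.nodup_neg).2,
    (List.pairwise_cons.1 hm.sorted_neg).2, hm.best.better j, hm.anchor_eq_none, fun h => ?_⟩
  obtain ⟨g, hg, hga⟩ := hm.anchor h
  exact ⟨g, hg.of_prefix (hist_append as (some j) x ▸ List.prefix_append _ _), hga⟩

theorem eq_of_weights_mixLottery_ne_zero {i j : Fin K} {v w : ℝ} {a : Option (Fin K)}
    (h : (mixLottery i v j w).val.weights a ≠ 0) : a = some i ∨ a = some j := by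
  by_contra! hne
  exact h (by simp [mixLottery, Lottery.weights, hne.1, hne.2])

theorem eq_of_weights_pickLottery_ne_zero {a c : Option (Fin K)}
    (h : (pickLottery c).val.weights a ≠ 0) : a = c := by
  rw [weights_pickLottery] at h
  by_contra hne
  exact h (if_neg hne)

theorem Tracks.update (hμ : ∀ i, μ i ≠ 0) {m : Memory K} (hm : Tracks μ as x m)
    {a : Option (Fin K)} (ha : (play μ m).val.weights a ≠ 0) :
    Tracks μ (as ++ [a]) x (update m (a, reward x a)).val := by
  have hanchor := @Tracks.anchor_mem _ _ _ _ _ hm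
  rcases m with ⟨_ | ⟨i, l⟩, _ | ⟨j, l'⟩, b, c⟩
  · have hupd : (IRSR.update ⟨[], [], b, c⟩ (a, reward x a)).val = ⟨[], [], b, c⟩ := rfl
    rw [hupd]
    refine hm.append_seen fun k hk => ?_
    rcases c with _ | ⟨k', y⟩
    · have := eq_of_weights_pickLottery_ne_zero (c := none) ha
      rw [hk] at this
      exact absurd this (by simp)
    · have := eq_of_weights_pickLottery_ne_zero (c := b.map Prod.fst) ha
      rw [hk] at this
      obtain ⟨⟨k2, y2⟩, hb, rfl⟩ := Option.map_eq_some_iff.1 this.symm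
      exact (hm.best.1 k2 y2 hb).1
  · rcases c with _ | ⟨k, y⟩
    · have hupd : (IRSR.update ⟨[], j :: l', b, none⟩ (a, reward x a)).val =
        ⟨[], j :: l', b, none⟩ := rfl
      rw [hupd]
      refine hm.append_seen fun k hk => ?_
      have := eq_of_weights_pickLottery_ne_zero (c := none) ha
      rw [hk] at this
      exact absurd this (by simp)
    · have hk := hanchor (k := k) (y := y) rfl
      have hj := (hm.mem_neg j).1 List.mem_cons_self
      have hkj : k ≠ j := by
        rintro rfl
        exact mem_unseen.1 hj.1 hk
      rcases eq_of_weights_mixLottery_ne_zero (i := k) (j := j) (v := y) (w := μ j) ha with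
        rfl | rfl
      · have hupd : (IRSR.update ⟨[], j :: l', b, some (k, y)⟩ (some k, reward x (some k))).val =
            ⟨[], j :: l', b, some (k, y)⟩ := by simp [IRSR.update, hkj]
        rw [hupd]
        refine hm.append_seen fun k' hk' => ?_
        rwa [← hk']
      · have hupd : (IRSR.update ⟨[], j :: l', b, some (k, y)⟩ (some j, reward x (some j))).val =
            ⟨[], l', (better b j (x j)).val, some (k, y)⟩ := by simp [IRSR.update, reward]
        rw [hupd]
        exact hm.explore_neg
  · obtain rfl := eq_of_weights_pickLottery_ne_zero (c := some i) ha
    have hupd : (IRSR.update ⟨i :: l, [], b, c⟩ (some i, reward x (some i))).val =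
        ⟨l, [], (better b i (x i)).val, (chooseAnchor l (better b i (x i)).val).val⟩ := by
      simp [IRSR.update, reward]
    rw [hupd]
    exact hm.explore_pos hμ
  · rcases eq_of_weights_mixLottery_ne_zero (i := i) (j := j) (v := μ i) (w := μ j) ha with
      rfl | rfl
    · have hupd : (IRSR.update ⟨i :: l, j :: l', b, c⟩ (some i, reward x (some i))).val =
          ⟨l, j :: l', (better b i (x i)).val,
            (chooseAnchor l (better b i (x i)).val).val⟩ := by
        simp [IRSR.update, reward]
      rw [hupd]
      exact hm.explore_pos hμ
    · have hij : j ≠ i := by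
        rintro rfl
        exact ((hm.mem_pos j).1 List.mem_cons_self).2.not_gt
          ((hm.mem_neg j).1 List.mem_cons_self).2
      have hupd : (IRSR.update ⟨i :: l, j :: l', b, c⟩ (some j, reward x (some j))).val =
          ⟨i :: l, l', (better b j (x j)).val, c⟩ := by
        simp [IRSR.update, reward, hij]
      rw [hupd]
      exact hm.explore_neg

theorem tracks_memoryAfter (hμ : ∀ i, μ i ≠ 0) (as : List (Option (Fin K))) (x : Fin K → ℝ)
    (hp : Possible (program μ) (hist as x)) : Tracks μ as x (memoryAfter μ (hist as x)) := by
  induction as using List.reverseRecOn with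
  | nil => exact tracks_prepare hμ x
  | append_singleton as a ih =>
    rw [hist_append] at hp ⊢
    have hp' : Possible (program μ) (hist as x) :=
      ⟨⟨x, fun e he => by obtain ⟨b, -, rfl⟩ := List.mem_map.1 he; rfl⟩,
        fun g e hg => hp.2 g e (hg.trans (List.prefix_append _ _))⟩
    have ha := hp.2 (hist as x) (a, reward x a) List.prefix_rfl
    rw [memoryAfter, List.foldl_append]
    exact (ih hp').update hμ ha.ne'

theorem isIREGB_program (hμ : ∀ i, μ i ≠ 0) : IsIREGB μ (program μ) := by
  intro h hp
  obtain ⟨as, x, rfl⟩ := hp.exists_hist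
  exact (tracks_memoryAfter hμ as x hp).move hμ

end Program

/-! ### Comparison of the welfare of IREGB with the optimum -/

section Welfare

variable {Ω : Type*} [MeasurableSpace Ω] {P : Measure Ω} {K : ℕ} {X : Fin K → Ω → ℝ}
  {M : Strategy K}

theorem SW_eq_div (P : Measure Ω) (X : Fin K → Ω → ℝ) (M : Strategy K) (T : ℕ) :
    SW P X M T = (∫ ω, 1 * totalReward M (fun i => X i ω) T (hist [] fun i => X i ω) ∂P) / T := by
  simp only [SW, one_mul, hist, List.map_nil]
  rw [integral_const_mul]
  ring

/-- The initial potential bounds the welfare of all MIR mechanisms. The horizon zero, where the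
welfare is `0` by the convention for division, is excluded. -/
theorem SW_le_potential [IsProbabilityMeasure P] (hX : ∀ i, Measurable (X i))
    (hint : ∀ i, Integrable (X i) P) (hindep : iIndepFun X P) (hmean : ∀ i, mean P X i ≠ 0)
    {L κ : Finset (Fin K) → ℝ} (hL : IsLoss (mean P X) (fun i => P.real {ω | X i ω ≤ 0})
      (fun s => ∫ ω, bestReward s (fun i => X i ω) ∂P) L κ)
    (hM : IsMechanism M) (hmir : IsMIR (mean P X) M) {T : ℕ} (hT : 0 < T) :
    SW P X M T ≤ ∫ ω, 1 * potential L [] (fun i => X i ω) ∂P := by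
  rw [SW_eq_div, div_le_iff₀ (by exact_mod_cast hT), mul_comm _ (T : ℝ)]
  exact integral_weight_totalReward_le hX hint hindep hmean hL hM hmir T (isWeight_one M X)

theorem bddAbove_achievable [IsProbabilityMeasure P] (hX : ∀ i, Measurable (X i))
    (hint : ∀ i, Integrable (X i) P) (hindep : iIndepFun X P) (hmean : ∀ i, mean P X i ≠ 0)
    (hord : NegStochOrdered P X) (T : ℕ) : BddAbove (achievable P X T) := by
  obtain ⟨L, κ, hL⟩ := exists_isLoss_of_negStochOrdered hX hint hindep hmean hord
  refine ⟨max (∫ ω, 1 * potential L [] (fun i => X i ω) ∂P) 0, ?_⟩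
  rintro _ ⟨M, hM, hmir, rfl⟩
  rcases Nat.eq_zero_or_pos T with rfl | hT
  · refine le_max_of_le_right ?_
    simp [SW]
  · exact le_max_of_le_left (SW_le_potential hX hint hindep hmean hL hM hmir hT)

theorem tendsto_SW [IsProbabilityMeasure P] (hX : ∀ i, Measurable (X i))
    (hint : ∀ i, Integrable (X i) P) (hindep : iIndepFun X P)
    {L κ : Finset (Fin K) → ℝ} (hL : IsLoss (mean P X) (fun i => P.real {ω | X i ω ≤ 0})
      (fun s => ∫ ω, bestReward s (fun i => X i ω) ∂P) L κ)
    (hmech : IsMechanism M) (hM : IsIREGB (mean P X) M) :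
    Tendsto (SW P X M) atTop (𝓝 (∫ ω, 1 * potential L [] (fun i => X i ω) ∂P)) := by
  have := tendsto_integral_weight_totalReward hX hint hindep hL hmech hM _ (isWeight_one M X) rfl
    fun bs hbs hne => absurd (List.prefix_nil.1 hbs) hne
  exact this.congr fun T => (SW_eq_div P X M T).symm

theorem tendsto_OPT [IsProbabilityMeasure P] (hX : ∀ i, Measurable (X i))
    (hint : ∀ i, Integrable (X i) P) (hindep : iIndepFun X P) (hmean : ∀ i, mean P X i ≠ 0)
    (hord : NegStochOrdered P X) {L κ : Finset (Fin K) → ℝ}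
    (hL : IsLoss (mean P X) (fun i => P.real {ω | X i ω ≤ 0})
      (fun s => ∫ ω, bestReward s (fun i => X i ω) ∂P) L κ)
    (hmech : IsMechanism M) (hM : IsIREGB (mean P X) M) :
    Tendsto (OPT P X) atTop (𝓝 (∫ ω, 1 * potential L [] (fun i => X i ω) ∂P)) := by
  have hach : ∀ T, SW P X M T ∈ achievable P X T := fun T =>
    ⟨M, hmech, isMIR_of_isIREGB hM, rfl⟩
  refine tendsto_of_tendsto_of_tendsto_of_le_of_le' (tendsto_SW hX hint hindep hL hmech hM)
    tendsto_const_nhds (Eventually.of_forall fun T =>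
      le_csSup (bddAbove_achievable hX hint hindep hmean hord T) (hach T)) ?_
  filter_upwards [eventually_gt_atTop 0] with T hT
  refine csSup_le ⟨_, hach T⟩ ?_
  rintro _ ⟨M', hM', hmir, rfl⟩
  exact SW_le_potential hX hint hindep hmean hL hM' hmir hT

end Welfare

end IRSR

theorem corollary1 {Ω : Type*} [MeasurableSpace Ω] (P : Measure Ω) [IsProbabilityMeasure P]
    {K : ℕ} (X : Fin K → Ω → ℝ)
    (hmeas : ∀ i, Measurable (X i))
    (hint : ∀ i, Integrable (X i) P)
    (hindep : iIndepFun X P)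
    (hmean : ∀ i, mean P X i ≠ 0)
    (hord : NegStochOrdered P X) :
    -- the optimum over MIR mechanisms is well defined for every horizon, and converges
    (∀ T : ℕ, IsLUB (achievable P X T) (OPT P X T)) ∧
    (∃ OPTinf : ℝ, Tendsto (OPT P X) atTop (𝓝 OPTinf) ∧
      -- every execution of IREGB is MIR and asymptotically optimal
      ∀ M : Strategy K, IsMechanism M → IsIREGB (mean P X) M →
        IsMIR (mean P X) M ∧ Tendsto (SW P X M) atTop (𝓝 OPTinf)) ∧
    -- the implementation computes an execution of IREGB
    (IsMechanism (program (mean P X)) ∧ IsIREGB (mean P X) (program (mean P X))) ∧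
    -- and runs in time `O(K log K)`, with a constant that does not depend on the instance
    (∃ C : ℝ, ∀ n : ℕ, 2 ≤ n → ∀ μ : Fin n → ℝ,
      (∀ h : History n, (planningCost μ h : ℝ) ≤ C * (n * Real.log n)) ∧
      ∀ (m : Memory n) (e : Option (Fin n) × ℝ), (roundCost μ m e : ℝ) ≤ C) := by
  have hprog := isMechanism_program hmean
  have hprog' := isIREGB_program hmean
  refine ⟨fun T => ?_, ?_, ⟨hprog, hprog'⟩, 100, fun n hn μ => ⟨planningCost_le μ hn, ?_⟩⟩
  · exact isLUB_csSup ⟨_, program (mean P X), hprog, isMIR_of_isIREGB hprog', rfl⟩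
      (bddAbove_achievable hmeas hint hindep hmean hord T)
  · obtain ⟨L, κ, hL⟩ := exists_isLoss_of_negStochOrdered hmeas hint hindep hmean hord
    exact ⟨_, tendsto_OPT hmeas hint hindep hmean hord hL hprog hprog', fun M hM hM' =>
      ⟨isMIR_of_isIREGB hM', tendsto_SW hmeas hint hindep hL hM hM'⟩⟩
  · intro m e
    have : (roundCost μ m e : ℝ) ≤ 18 := by exact_mod_cast roundCost_le μ m e
    linarith
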